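/- Let $n \ge 1$. An affine permutation of size $n$ is a bijection $\sigma : \mathbb{Z} \to \mathbb{Z}$ such that $\sigma(i+n) = \sigma(i)+n$ for all $i \in \mathbb{Z}$ and $\sum_{i=1}^n \sigma(i) = \sum_{i=1}^n i$. It contains a permutation $\tau$ of $\{1,\dots,k\}$ as a pattern if there are integers $i_1 < \cdots < i_k$ such that $\sigma(i_1),\dots,\sigma(i_k)$ are in the same relative order as $\tau(1),\dots,\tau(k)$, and otherwise it avoids $\tau$. Let $\widetilde{S}_n(\tau)$ be the set of affine permutations of size $n$ that avoid $\tau$. Then, for every $n \ge 1$, the sets $\widetilde{S}_n(231)$, $\widetilde{S}_n(312)$, $\widetilde{S}_n(3142)$ and $\widetilde{S}_n(2413)$ are finite, and $$|\widetilde{S}_n(231)| = |\widetilde{S}_n(312)| = \binom{2n-1}{n},$$ $$|\widetilde{S}_n(3142)| = |\widetilde{S}_n(2413)| = \sum_{k=0}^{n-1} \frac{n-k}{n} \binom{n-1+k}{k} 2^k.$$ -/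

import Mathlib

/-- `σ` is an affine permutation of size `n`: a bijection `ℤ → ℤ` with
`σ (i + n) = σ i + n` for all `i`, and `σ 1 + ⋯ + σ n = 1 + ⋯ + n`. -/
def IsAffinePerm (n : ℕ) (σ : Equiv.Perm ℤ) : Prop :=
  (∀ i : ℤ, σ (i + n) = σ i + n) ∧
    ∑ i ∈ Finset.Icc (1 : ℤ) n, σ i = ∑ i ∈ Finset.Icc (1 : ℤ) n, i

/-- `σ : ℤ → ℤ` contains the ordinary permutation `τ` of size `k` as a pattern: some positions
`φ 0 < ⋯ < φ (k - 1)` carry entries in the same relative order as `τ 0, …, τ (k - 1)`. -/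
def ContainsPattern {k : ℕ} (σ : Equiv.Perm ℤ) (τ : Equiv.Perm (Fin k)) : Prop :=
  ∃ φ : Fin k → ℤ, StrictMono φ ∧ ∀ a b : Fin k, σ (φ a) < σ (φ b) ↔ τ a < τ b

/-- The set of affine permutations of size `n` that avoid the pattern `τ`. -/
def affineAvoiders (n : ℕ) {k : ℕ} (τ : Equiv.Perm (Fin k)) : Set (Equiv.Perm ℤ) :=
  {σ | IsAffinePerm n σ ∧ ¬ ContainsPattern σ τ}

/-- The permutation `231` in one-line notation (entries lowered by one). -/
def perm231 : Equiv.Perm (Fin 3) where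
  toFun := ![1, 2, 0]
  invFun := ![2, 0, 1]
  left_inv := by decide
  right_inv := by decide

/-- The permutation `312` in one-line notation (entries lowered by one). -/
def perm312 : Equiv.Perm (Fin 3) where
  toFun := ![2, 0, 1]
  invFun := ![1, 2, 0]
  left_inv := by decide
  right_inv := by decide

/-- The permutation `3142` in one-line notation (entries lowered by one). -/
def perm3142 : Equiv.Perm (Fin 4) where
  toFun := ![2, 0, 3, 1]
  invFun := ![1, 3, 0, 2]
  left_inv := by decide
  right_inv := by decide

/-- The permutation `2413` in one-line notation (entries lowered by one). -/
def perm2413 : Equiv.Perm (Fin 4) where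
  toFun := ![1, 3, 0, 2]
  invFun := ![2, 0, 3, 1]
  left_inv := by decide
  right_inv := by decide

/-! Call `k` a cut if all values before position `k` are smaller than all values from `k` on. An
affine permutation that avoids 231 or 2413 always has a cut (`exists_isCutOf_of_avoids231`,
`exists_isCutOf_of_avoids2413`). The sum condition then forces the half-line above the cut to be
mapped to itself, so the affine permutation is a translated periodic repetition of a permutation of
size `n`. Both patterns are sum-indecomposable, so they occur in the repetition only if they occur
inside one period. Starting the period at the greatest cut that is at most 0 makes the description
unique: affine avoiders correspond to finite avoiders with a marked position, that of 0, in the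
first sum-indecomposable block (`affineAvoiders_finite_and_ncard`).

Let `C` be the generating function of the finite avoiders and `M` that of the marked ones. Splitting
a permutation with an arbitrary marked position in front of the block that holds the mark gives `M C
= X C'` (`markedSeries_mul`).

For 231, `C = 1 + X C²`, whence `M = (B - 1) / 2` with `B` the series of central binomial
coefficients.

For 2413, a permutation either ends with its maximum or arises from a smaller one by appending a
block of consecutive values (`exists_eq_appendBlock`). Counting with a catalytic variable `u` for
the gaps where an entry may still be appended gives two linear relations between the open-gap series
and a companion series; eliminating the companion leaves an equation quadratic in the first.
Choosing a series `U` for `u` at which the derivative with respect to the unknown vanishes makes the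
derivative in `u` vanish too, and the resulting system gives `(1 + X) U² - 3 U + 2 = 0` and `C = U²
(2 - U)`. Then `M = U - 1`, and `U = 1 / (1 - X c)` with `c` the Catalan series at `2 X`, whose
powers have ballot numbers as coefficients.

The patterns 312 and 3142 are the inverses of 231 and 2413, and inversion preserves affine
permutations. -/

/-! ### Short sublists of concatenations and images. -/

open List in
theorem pair_sublist_append {α : Type*} {a b : α} {X Y : List α} :
    [a, b] <+ X ++ Y ↔ [a, b] <+ X ∨ (a ∈ X ∧ b ∈ Y) ∨ [a, b] <+ Y := by
  rw [List.sublist_append_iff]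
  constructor
  · rintro ⟨l₁, l₂, h, h1, h2⟩
    rcases l₁ with _ | ⟨x, _ | ⟨y, _ | ⟨z, t⟩⟩⟩ <;> simp at h
    · subst h; exact .inr (.inr h2)
    · obtain ⟨rfl, rfl⟩ := h; exact .inr (.inl ⟨by simpa using h1, by simpa using h2⟩)
    · obtain ⟨rfl, rfl, rfl⟩ := h; exact .inl h1
  · rintro (h | ⟨h, h'⟩ | h)
    · exact ⟨_, [], by simp, h, by simp⟩
    · exact ⟨[a], [b], by simp, by simpa using h, by simpa using h'⟩
    · exact ⟨[], _, by simp, by simp, h⟩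

open List in
theorem triple_sublist_append {α : Type*} {a b c : α} {X Y : List α} :
    [a, b, c] <+ X ++ Y ↔ [a, b, c] <+ X ∨ ([a, b] <+ X ∧ c ∈ Y) ∨ (a ∈ X ∧ [b, c] <+ Y) ∨
      [a, b, c] <+ Y := by
  rw [List.sublist_append_iff]
  constructor
  · rintro ⟨l₁, l₂, h, h1, h2⟩
    rcases l₁ with _ | ⟨x, _ | ⟨y, _ | ⟨z, _ | ⟨w, t⟩⟩⟩⟩ <;> simp at h
    · subst h; exact .inr (.inr (.inr h2))
    · obtain ⟨rfl, rfl⟩ := h; exact .inr (.inr (.inl ⟨by simpa using h1, h2⟩))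
    · obtain ⟨rfl, rfl, rfl⟩ := h; exact .inr (.inl ⟨h1, by simpa using h2⟩)
    · obtain ⟨rfl, rfl, rfl, rfl⟩ := h; exact .inl h1
  · rintro (h | ⟨h, h'⟩ | ⟨h, h'⟩ | h)
    · exact ⟨_, [], by simp, h, by simp⟩
    · exact ⟨[a, b], [c], by simp, h, by simpa using h'⟩
    · exact ⟨[a], [b, c], by simp, by simpa using h, h'⟩
    · exact ⟨[], _, by simp, by simp, h⟩

open List in
theorem quadruple_sublist_append {α : Type*} {a b c d : α} {X Y : List α} :
    [a, b, c, d] <+ X ++ Y ↔ [a, b, c, d] <+ X ∨ ([a, b, c] <+ X ∧ d ∈ Y) ∨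
      ([a, b] <+ X ∧ [c, d] <+ Y) ∨ (a ∈ X ∧ [b, c, d] <+ Y) ∨ [a, b, c, d] <+ Y := by
  rw [List.sublist_append_iff]
  constructor
  · rintro ⟨l₁, l₂, h, h1, h2⟩
    rcases l₁ with _ | ⟨x, _ | ⟨y, _ | ⟨z, _ | ⟨w, _ | ⟨v, t⟩⟩⟩⟩⟩ <;> simp at h
    · subst h; exact .inr (.inr (.inr (.inr h2)))
    · obtain ⟨rfl, rfl⟩ := h; exact .inr (.inr (.inr (.inl ⟨by simpa using h1, h2⟩)))
    · obtain ⟨rfl, rfl, rfl⟩ := h; exact .inr (.inr (.inl ⟨h1, h2⟩))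
    · obtain ⟨rfl, rfl, rfl, rfl⟩ := h; exact .inr (.inl ⟨h1, by simpa using h2⟩)
    · obtain ⟨rfl, rfl, rfl, rfl, rfl⟩ := h; exact .inl h1
  · rintro (h | ⟨h, h'⟩ | ⟨h, h'⟩ | ⟨h, h'⟩ | h)
    · exact ⟨_, [], by simp, h, by simp⟩
    · exact ⟨[a, b, c], [d], by simp, h, by simpa using h'⟩
    · exact ⟨[a, b], [c, d], by simp, h, h'⟩
    · exact ⟨[a], [b, c, d], by simp, by simpa using h, h'⟩
    · exact ⟨[], _, by simp, by simp, h⟩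

open List in
theorem pair_sublist_map {α β : Type*} {f : α → β} {l : List α} {a b : β} :
    [a, b] <+ l.map f ↔ ∃ a' b', [a', b'] <+ l ∧ f a' = a ∧ f b' = b := by
  rw [List.sublist_map_iff]
  constructor
  · rintro ⟨l', h, e⟩
    rcases l' with _ | ⟨x, _ | ⟨y, _ | ⟨z, t⟩⟩⟩ <;> simp at e
    exact ⟨x, y, h, e.1.symm, e.2.symm⟩
  · rintro ⟨x, y, h, rfl, rfl⟩; exact ⟨_, h, rfl⟩

open List in
theorem triple_sublist_map {α β : Type*} {f : α → β} {l : List α} {a b c : β} :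
    [a, b, c] <+ l.map f ↔ ∃ a' b' c', [a', b', c'] <+ l ∧ f a' = a ∧ f b' = b ∧ f c' = c := by
  rw [List.sublist_map_iff]
  constructor
  · rintro ⟨l', h, e⟩
    rcases l' with _ | ⟨x, _ | ⟨y, _ | ⟨z, _ | ⟨w, t⟩⟩⟩⟩ <;> simp at e
    exact ⟨x, y, z, h, e.1.symm, e.2.1.symm, e.2.2.symm⟩
  · rintro ⟨x, y, z, h, rfl, rfl, rfl⟩; exact ⟨_, h, rfl⟩

open List in
theorem quadruple_sublist_map {α β : Type*} {f : α → β} {l : List α} {a b c d : β} :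
    [a, b, c, d] <+ l.map f ↔
      ∃ a' b' c' d', [a', b', c', d'] <+ l ∧ f a' = a ∧ f b' = b ∧ f c' = c ∧ f d' = d := by
  rw [List.sublist_map_iff]
  constructor
  · rintro ⟨l', h, e⟩
    rcases l' with _ | ⟨x, _ | ⟨y, _ | ⟨z, _ | ⟨w, _ | ⟨v, t⟩⟩⟩⟩⟩ <;> simp at e
    exact ⟨x, y, z, w, h, e.1.symm, e.2.1.symm, e.2.2.1.symm, e.2.2.2.symm⟩
  · rintro ⟨x, y, z, w, h, rfl, rfl, rfl, rfl⟩; exact ⟨_, h, rfl⟩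

theorem List.perm_range_iff {l : List ℕ} {n : ℕ} :
    l.Perm (List.range n) ↔ l.Nodup ∧ ∀ x, x ∈ l ↔ x < n := by
  constructor
  · intro h
    exact ⟨h.nodup_iff.2 List.nodup_range, fun x => by rw [h.mem_iff, List.mem_range]⟩
  · rintro ⟨h, h'⟩
    exact (List.perm_ext_iff_of_nodup h List.nodup_range).2 fun x => by rw [h', List.mem_range]

theorem List.perm_range_length {l : List ℕ} {n : ℕ} (h : l.Perm (List.range n)) :
    l.length = n := by simpa using h.length_eq

/-! ### Finite avoiders, value gaps and block insertion. -/

/-- A list of naturals avoids `231`. -/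
def Avoids231 (l : List ℕ) : Prop :=
  ∀ a b c, List.Sublist [b, c, a] l → a < b → b < c → False

/-- A list of naturals avoids `2413`. -/
def Avoids2413 (l : List ℕ) : Prop :=
  ∀ a b c d, List.Sublist [b, d, a, c] l → a < b → b < c → c < d → False

open Classical in
/-- The permutations of `0, …, n - 1`, in one-line notation, with property `P`. -/
noncomputable def permLists (P : List ℕ → Prop) (n : ℕ) : Finset (List ℕ) :=
  (List.range n).permutations.toFinset.filter P

theorem mem_permLists {P : List ℕ → Prop} {n : ℕ} {l : List ℕ} :
    l ∈ permLists P n ↔ l.Perm (List.range n) ∧ P l := by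
  simp [permLists]

/-- Appending an entry at the value gap `v` does not create a `2413`. -/
def IsOpenGap (l : List ℕ) (v : ℕ) : Prop :=
  ∀ a b d, List.Sublist [b, d, a] l → a < b → b < v → v ≤ d → False

open Classical in
/-- The value gaps at which an entry can be appended to `l` without creating a `2413`. -/
noncomputable def openGaps (l : List ℕ) : Finset ℕ :=
  (Finset.range (l.length + 1)).filter (IsOpenGap l)

open Classical in
/-- The open gaps below the maximum and below all entries to its right. -/
noncomputable def lowGaps (l : List ℕ) : Finset ℕ :=
  (openGaps l).filter fun v => v < l.length ∧ ∀ x, List.Sublist [l.length - 1, x] l → v < x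

theorem mem_openGaps {l : List ℕ} {v : ℕ} :
    v ∈ openGaps l ↔ v ≤ l.length ∧ IsOpenGap l v := by
  simp [openGaps]

theorem mem_lowGaps {l : List ℕ} {v : ℕ} :
    v ∈ lowGaps l ↔ IsOpenGap l v ∧ v < l.length ∧
      ∀ x, List.Sublist [l.length - 1, x] l → v < x := by
  simp only [lowGaps, Finset.mem_filter, mem_openGaps]
  constructor
  · rintro ⟨⟨h1, h2⟩, h3⟩; exact ⟨h2, h3⟩
  · rintro ⟨h2, h3, h4⟩; exact ⟨⟨h3.le, h2⟩, h3, h4⟩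

/-- Make room for `b` new values from `v` on. -/
def shiftFrom (v b x : ℕ) : ℕ := if x < v then x else x + b

/-- Append to `l`, at the value gap `v`, a copy of `B` occupying consecutive values. -/
def appendBlock (l : List ℕ) (v : ℕ) (B : List ℕ) : List ℕ :=
  l.map (shiftFrom v B.length) ++ B.map (v + ·)

theorem shiftFrom_lt_iff {v b x y : ℕ} : shiftFrom v b x < shiftFrom v b y ↔ x < y := by
  unfold shiftFrom; split_ifs <;> omega

theorem shiftFrom_injective (v b : ℕ) : Function.Injective (shiftFrom v b) := by
  intro x y; unfold shiftFrom; split_ifs <;> omega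

theorem appendBlock_perm {l B : List ℕ} {i b v : ℕ} (hl : l.Perm (List.range i))
    (hB : B.Perm (List.range b)) (hv : v ≤ i) :
    (appendBlock l v B).Perm (List.range (i + b)) := by
  have hb := List.perm_range_length hB
  rw [List.perm_range_iff] at *
  unfold appendBlock
  rw [hb]
  refine ⟨List.Nodup.append (hl.1.map (shiftFrom_injective _ _))
    (hB.1.map (add_right_injective v)) ?_, fun x => ?_⟩
  · rw [List.disjoint_left]
    simp only [List.mem_map, not_exists, not_and, forall_exists_index, and_imp]
    rintro _ x hx rfl y hy
    rw [hB.2] at hy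
    unfold shiftFrom; split_ifs <;> omega
  · simp only [List.mem_append, List.mem_map, hl.2, hB.2]
    constructor
    · rintro (⟨y, hy, rfl⟩ | ⟨y, hy, rfl⟩)
      · unfold shiftFrom; split_ifs <;> omega
      · omega
    · intro hx
      by_cases h1 : x < v
      · exact .inl ⟨x, by omega, by simp [shiftFrom, h1]⟩
      by_cases h2 : x < v + b
      · exact .inr ⟨x - v, by omega, by omega⟩
      · exact .inl ⟨x - b, by omega, by unfold shiftFrom; split_ifs <;> omega⟩

theorem avoids2413_append_top {l : List ℕ} {n : ℕ} (hl : l.Perm (List.range n)) :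
    Avoids2413 (l ++ [n]) ↔ Avoids2413 l := by
  rw [List.perm_range_iff] at hl
  constructor
  · intro h a b c d hs
    exact h a b c d (quadruple_sublist_append.2 (.inl hs))
  · intro h a b c d hs h1 h2 h3
    rcases quadruple_sublist_append.1 hs with hs | ⟨hs, hd⟩ | ⟨-, hs⟩ | ⟨-, hs⟩ | hs
    · exact h a b c d hs h1 h2 h3
    · have := (hl.2 d).1 (hs.subset (by simp))
      simp at hd; omega
    all_goals simpa using hs.length_le

theorem isOpenGap_append_top {l : List ℕ} {n v : ℕ} (hl : l.Perm (List.range n)) :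
    IsOpenGap (l ++ [n]) v ↔ IsOpenGap l v := by
  rw [List.perm_range_iff] at hl
  constructor
  · intro h a b d hs
    exact h a b d (triple_sublist_append.2 (.inl hs))
  · intro h a b d hs h1 h2 h3
    rcases triple_sublist_append.1 hs with hs | ⟨hs, hd⟩ | ⟨-, hs⟩ | hs
    · exact h a b d hs h1 h2 h3
    · have := (hl.2 b).1 (hs.subset (by simp))
      simp at hd; omega
    all_goals simpa using hs.length_le

theorem openGaps_append_top {l : List ℕ} {n : ℕ} (hl : l.Perm (List.range n)) :
    openGaps (l ++ [n]) = insert (n + 1) (openGaps l) := by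
  ext v
  simp only [mem_openGaps, isOpenGap_append_top hl, Finset.mem_insert, List.length_append,
    List.length_singleton, List.perm_range_length hl]
  constructor
  · rintro ⟨h1, h2⟩
    rcases Nat.lt_or_ge n v with h | h
    · exact .inl (by omega)
    · exact .inr ⟨h, h2⟩
  · rintro (rfl | ⟨h1, h2⟩)
    · refine ⟨le_rfl, fun a b d hs h1 h2 h3 => ?_⟩
      have := ((List.perm_range_iff.1 hl).2 d).1 (hs.subset (by simp))
      omega
    · exact ⟨by omega, h2⟩

/-- Nothing stands to the right of the new maximum, so every old open gap becomes low. -/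
theorem lowGaps_append_top {l : List ℕ} {n : ℕ} (hl : l.Perm (List.range n)) :
    lowGaps (l ++ [n]) = openGaps l := by
  ext v
  simp only [mem_lowGaps, mem_openGaps, isOpenGap_append_top hl, List.length_append,
    List.length_singleton, List.perm_range_length hl, Nat.add_sub_cancel]
  constructor
  · rintro ⟨h1, h2, -⟩; exact ⟨by omega, h1⟩
  · rintro ⟨h1, h2⟩
    refine ⟨h2, by omega, fun x hs => ?_⟩
    have hn : n ∉ l := fun h => lt_irrefl _ (((List.perm_range_iff.1 hl).2 n).1 h)
    rcases pair_sublist_append.1 hs with hs | ⟨hs, -⟩ | hs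
    · exact absurd (hs.subset (by simp)) hn
    · exact absurd hs hn
    · simpa using hs.length_le

theorem card_openGaps_append_top {l : List ℕ} {n : ℕ} (hl : l.Perm (List.range n)) :
    (openGaps (l ++ [n])).card = (openGaps l).card + 1 := by
  rw [openGaps_append_top hl, Finset.card_insert_of_notMem]
  rw [mem_openGaps, List.perm_range_length hl]
  omega

/-- The block is an interval in value placed at the end. An occurrence with two or more entries in
the block and some outside would have its 1 and 3 inside and its 2 outside, although 2 lies between
them in value. The only mixed split is 241 before the block and 3 inside it, which the open gap
excludes. -/
theorem avoids2413_appendBlock {l B : List ℕ} {b v : ℕ}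
    (hB : B.Perm (List.range b)) (hb : 0 < b) :
    Avoids2413 (appendBlock l v B) ↔ Avoids2413 l ∧ Avoids2413 B ∧ IsOpenGap l v := by
  have hb' := List.perm_range_length hB
  rw [List.perm_range_iff] at hB
  unfold appendBlock
  rw [hb']
  constructor
  · intro h
    refine ⟨fun a b c d hs h1 h2 h3 => ?_, fun a b c d hs h1 h2 h3 => ?_,
      fun a b' d hs h1 h2 h3 => ?_⟩
    · refine h _ _ _ _ (quadruple_sublist_append.2 (.inl (quadruple_sublist_map.2
        ⟨_, _, _, _, hs, rfl, rfl, rfl, rfl⟩))) ?_ ?_ ?_ <;> rwa [shiftFrom_lt_iff]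
    · refine h _ _ _ _ (quadruple_sublist_append.2 (.inr (.inr (.inr (.inr
        (quadruple_sublist_map.2 ⟨_, _, _, _, hs, rfl, rfl, rfl, rfl⟩)))))) ?_ ?_ ?_ <;> omega
    -- The smallest entry of the block plays the 3; it exists because the block is nonempty.
    · refine h _ _ (v + 0) _ (quadruple_sublist_append.2 (.inr (.inl ⟨triple_sublist_map.2
        ⟨_, _, _, hs, rfl, rfl, rfl⟩, List.mem_map.2 ⟨0, (hB.2 0).2 hb, rfl⟩⟩))) ?_ ?_ ?_
      all_goals unfold shiftFrom; split_ifs <;> omega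
  · rintro ⟨h, h', h''⟩ p q r s hs h1 h2 h3
    rcases quadruple_sublist_append.1 hs with hs | ⟨hs, hd⟩ | ⟨hs, hs'⟩ | ⟨hs, hs'⟩ | hs
    · obtain ⟨q', s', p', r', hm, rfl, rfl, rfl, rfl⟩ := quadruple_sublist_map.1 hs
      rw [shiftFrom_lt_iff] at h1 h2 h3
      exact h _ _ _ _ hm h1 h2 h3
    · obtain ⟨q', s', p', hm, rfl, rfl, rfl⟩ := triple_sublist_map.1 hs
      obtain ⟨y, hy, rfl⟩ := List.mem_map.1 hd
      rw [shiftFrom_lt_iff] at h1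
      have hy' := (hB.2 y).1 hy
      refine h'' _ _ _ hm h1 ?_ ?_
      · unfold shiftFrom at h2; split_ifs at h2 <;> omega
      · unfold shiftFrom at h3; split_ifs at h3 <;> omega
    · obtain ⟨q', s', hm, rfl, rfl⟩ := pair_sublist_map.1 hs
      obtain ⟨p', r', hm', rfl, rfl⟩ := pair_sublist_map.1 hs'
      have := (hB.2 r').1 (hm'.subset (by simp))
      unfold shiftFrom at h1 h2; split_ifs at h1 h2 <;> omega
    · obtain ⟨q', hm, rfl⟩ := List.mem_map.1 hs
      obtain ⟨s', p', r', hm', rfl, rfl, rfl⟩ := triple_sublist_map.1 hs'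
      have := (hB.2 r').1 (hm'.subset (by simp))
      unfold shiftFrom at h1 h2; split_ifs at h1 h2 <;> omega
    · obtain ⟨q', s', p', r', hm, rfl, rfl, rfl, rfl⟩ := quadruple_sublist_map.1 hs
      exact h' _ _ _ _ hm (by omega) (by omega) (by omega)

theorem isOpenGap_appendBlock_of_lt {l B : List ℕ} {v w : ℕ} (hw : w < v) :
    IsOpenGap (appendBlock l v B) w ↔ IsOpenGap l w := by
  unfold appendBlock
  constructor
  · intro h a b d hs h1 h2 h3
    refine h _ _ _ (triple_sublist_append.2 (.inl (triple_sublist_map.2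
      ⟨_, _, _, hs, rfl, rfl, rfl⟩))) (shiftFrom_lt_iff.2 h1) ?_ ?_ <;>
    unfold shiftFrom <;> split_ifs <;> omega
  · intro h a b d hs h1 h2 h3
    rcases triple_sublist_append.1 hs with hs | ⟨-, ha⟩ | ⟨-, hm⟩ | hm
    · obtain ⟨b', d', a', hm, rfl, rfl, rfl⟩ := triple_sublist_map.1 hs
      refine h _ _ _ hm (shiftFrom_lt_iff.1 h1) ?_ ?_
      · unfold shiftFrom at h2; split_ifs at h2 <;> omega
      · unfold shiftFrom at h3; split_ifs at h3 <;> omega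
    · obtain ⟨y, -, rfl⟩ := List.mem_map.1 ha
      omega
    · obtain ⟨y, -, rfl⟩ := List.mem_map.1 (hm.subset (by simp : a ∈ [d, a]))
      omega
    · obtain ⟨y, -, rfl⟩ := List.mem_map.1 (hm.subset (by simp : a ∈ [b, d, a]))
      omega

theorem isOpenGap_appendBlock_add {l B : List ℕ} {v y : ℕ} (hy : y ≤ B.length)
    (hv : IsOpenGap l v) : IsOpenGap (appendBlock l v B) (v + y) ↔ IsOpenGap B y := by
  unfold appendBlock
  constructor
  · intro h a b d hs h1 h2 h3
    exact h _ _ _ (triple_sublist_append.2 (.inr (.inr (.inr (triple_sublist_map.2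
      ⟨_, _, _, hs, rfl, rfl, rfl⟩))))) (by omega) (by omega) (by omega)
  · intro h a b d hs h1 h2 h3
    rcases triple_sublist_append.1 hs with hs | ⟨hm, ha⟩ | ⟨hb, hm⟩ | hs
    · obtain ⟨b', d', a', hm, rfl, rfl, rfl⟩ := triple_sublist_map.1 hs
      refine hv _ _ _ hm (shiftFrom_lt_iff.1 h1) ?_ ?_
      · unfold shiftFrom at h2; split_ifs at h2 <;> omega
      · unfold shiftFrom at h3; split_ifs at h3 <;> omega
    · obtain ⟨x, -, rfl⟩ := List.mem_map.1 ha
      obtain ⟨b', -, rfl⟩ := List.mem_map.1 (hm.subset (by simp : b ∈ [b, d]))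
      unfold shiftFrom at h1 h2; split_ifs at h1 h2 <;> omega
    · obtain ⟨x, -, rfl⟩ := List.mem_map.1 (hm.subset (by simp : a ∈ [d, a]))
      obtain ⟨b', -, rfl⟩ := List.mem_map.1 hb
      unfold shiftFrom at h1 h2; split_ifs at h1 h2 <;> omega
    · obtain ⟨b', d', a', hm, rfl, rfl, rfl⟩ := triple_sublist_map.1 hs
      exact h _ _ _ hm (by omega) (by omega) (by omega)

/-- Of two distinct entries, one precedes the other. -/
theorem pair_sublist_or_of_mem {α : Type*} {l : List α} {x y : α} (hx : x ∈ l) (hy : y ∈ l)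
    (h : x ≠ y) : List.Sublist [x, y] l ∨ List.Sublist [y, x] l := by
  obtain ⟨s, t, rfl⟩ := List.append_of_mem hx
  rcases List.mem_append.1 hy with hy | hy
  · exact .inr (pair_sublist_append.2 (.inr (.inl ⟨hy, by simp⟩)))
  · have : y ∈ t := (List.mem_cons.1 hy).resolve_left (Ne.symm h)
    exact .inl (pair_sublist_append.2 (.inr (.inr (by simpa using this))))

/-- Gaps below `v` keep their status and are low because `v` is; gaps inside the block are those of
`B`. Above the block only the topmost gap survives: the others are closed by the entry just above
the block, the maximum and an entry of the block. -/
theorem openGaps_appendBlock {l B : List ℕ} {i b v : ℕ} (hl : l.Perm (List.range i))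
    (hB : B.Perm (List.range b)) (hb : 0 < b) (hv : v ∈ lowGaps l) :
    openGaps (appendBlock l v B) =
      insert (i + b) ((lowGaps l).filter (· < v) ∪ (openGaps B).image (v + ·)) := by
  have hlen := List.perm_range_length (appendBlock_perm hl hB
    ((mem_lowGaps.1 hv).2.1.le.trans_eq (List.perm_range_length hl)))
  have hbl := List.perm_range_length hB
  have hil := List.perm_range_length hl
  obtain ⟨hv1, hv2, hv3⟩ := mem_lowGaps.1 hv
  have hcl := List.perm_range_iff.1 hl
  have hcB := List.perm_range_iff.1 hB
  rw [hil] at hv2 hv3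
  ext w
  simp only [mem_openGaps, hlen, Finset.mem_insert, Finset.mem_union, Finset.mem_filter,
    Finset.mem_image, mem_lowGaps, hil, hbl]
  constructor
  · rintro ⟨h1, h2⟩
    rcases lt_or_ge w v with hw | hw
    · exact .inr (.inl ⟨⟨(isOpenGap_appendBlock_of_lt hw).1 h2, by omega,
        fun x hx => hw.trans (hv3 x hx)⟩, hw⟩)
    obtain ⟨y, rfl⟩ := Nat.exists_eq_add_of_le hw
    rcases le_or_gt y b with hy | hy
    · exact .inr (.inr ⟨y, ⟨hy, (isOpenGap_appendBlock_add (hy.trans_eq hbl.symm) hv1).1 h2⟩,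
        rfl⟩)
    rcases h1.eq_or_lt with h1 | h1
    · exact .inl h1
    exfalso
    -- The entry `v` of `l` cannot follow the maximum, since the low gap `v` is strictly below
    -- everything there.
    have hm : List.Sublist [v, i - 1] l := by
      refine (pair_sublist_or_of_mem ((hcl.2 _).2 hv2) ((hcl.2 (i - 1)).2 (by omega))
        (by omega)).resolve_right fun h => lt_irrefl _ (hv3 _ h)
    refine h2 (v + 0) (shiftFrom v b v) (shiftFrom v b (i - 1)) (triple_sublist_append.2
      (.inr (.inl ⟨pair_sublist_map.2 ⟨_, _, hm, by rw [hbl], by rw [hbl]⟩,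
      List.mem_map.2 ⟨0, (hcB.2 0).2 hb, rfl⟩⟩))) ?_ ?_ ?_ <;>
    unfold shiftFrom <;> split_ifs <;> omega
  · rintro (rfl | ⟨⟨h1, h2, h3⟩, hw⟩ | ⟨y, ⟨hy, hy'⟩, rfl⟩)
    · refine ⟨le_rfl, fun a b d hs h1 h2 h3 => ?_⟩
      have hp := List.perm_range_iff.1 (appendBlock_perm hl hB hv2.le)
      have := (hp.2 d).1 (hs.subset (by simp))
      omega
    · exact ⟨by omega, (isOpenGap_appendBlock_of_lt hw).2 h1⟩
    · exact ⟨by omega, (isOpenGap_appendBlock_add (by omega) hv1).2 hy'⟩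

theorem card_openGaps_appendBlock {l B : List ℕ} {i b v : ℕ} (hl : l.Perm (List.range i))
    (hB : B.Perm (List.range b)) (hb : 0 < b) (hv : v ∈ lowGaps l) :
    (openGaps (appendBlock l v B)).card =
      ((lowGaps l).filter (· < v)).card + (openGaps B).card + 1 := by
  have hbl := List.perm_range_length hB
  have hil := List.perm_range_length hl
  have hvi := (mem_lowGaps.1 hv).2.1
  rw [openGaps_appendBlock hl hB hb hv, Finset.card_insert_of_notMem, Finset.card_union_of_disjoint,
    Finset.card_image_of_injective _ (add_right_injective v)]
  · rw [Finset.disjoint_left]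
    simp only [Finset.mem_filter, Finset.mem_image, not_exists, not_and, and_imp]
    intro w _ hw y _
    omega
  · simp only [Finset.mem_union, Finset.mem_filter, Finset.mem_image, mem_openGaps, not_or,
      not_exists, not_and]
    exact ⟨fun _ => by omega, fun y hy => by omega⟩

theorem sublist_max_appendBlock {l B : List ℕ} {i b v x : ℕ} (hl : l.Perm (List.range i))
    (hB : B.Perm (List.range b)) (hv : v ∈ lowGaps l) :
    List.Sublist [i + b - 1, x] (appendBlock l v B) ↔
      (∃ y, List.Sublist [i - 1, y] l ∧ shiftFrom v b y = x) ∨ (v ≤ x ∧ x < v + b) := by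
  have hbl := List.perm_range_length hB
  have hil := List.perm_range_length hl
  obtain ⟨hv1, hv2, hv3⟩ := mem_lowGaps.1 hv
  have hcl := List.perm_range_iff.1 hl
  have hcB := List.perm_range_iff.1 hB
  have hmax : shiftFrom v b (i - 1) = i + b - 1 := by
    unfold shiftFrom; split_ifs <;> omega
  unfold appendBlock
  rw [pair_sublist_append, hbl]
  constructor
  · rintro (hs | ⟨hs, hx⟩ | hs)
    · obtain ⟨p, q, hm, hp, rfl⟩ := pair_sublist_map.1 hs
      rw [← hmax] at hp
      rw [shiftFrom_injective _ _ hp] at hm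
      exact .inl ⟨q, hm, rfl⟩
    · obtain ⟨y, hy, rfl⟩ := List.mem_map.1 hx
      have := (hcB.2 y).1 hy
      exact .inr ⟨by omega, by omega⟩
    · obtain ⟨p, q, hm, hp, rfl⟩ := pair_sublist_map.1 hs
      have := (hcB.2 q).1 (hm.subset (by simp))
      exact .inr ⟨by omega, by omega⟩
  · rintro (⟨y, hy, rfl⟩ | ⟨h1, h2⟩)
    · exact .inl (pair_sublist_map.2 ⟨_, _, hy, hmax, rfl⟩)
    · exact .inr (.inl ⟨List.mem_map.2 ⟨i - 1, (hcl.2 _).2 (by omega), hmax⟩,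
        List.mem_map.2 ⟨x - v, (hcB.2 _).2 (by omega), by omega⟩⟩)

/-- The smallest block entry, of value `v`, now stands to the right of the maximum, so low gaps must
lie below `v`. -/
theorem lowGaps_appendBlock {l B : List ℕ} {i b v : ℕ} (hl : l.Perm (List.range i))
    (hB : B.Perm (List.range b)) (hb : 0 < b) (hv : v ∈ lowGaps l) :
    lowGaps (appendBlock l v B) = (lowGaps l).filter (· < v) := by
  have hlen := List.perm_range_length (appendBlock_perm hl hB
    ((mem_lowGaps.1 hv).2.1.le.trans_eq (List.perm_range_length hl)))
  have hil := List.perm_range_length hl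
  obtain ⟨hv1, hv2, hv3⟩ := mem_lowGaps.1 hv
  ext w
  simp only [mem_lowGaps, Finset.mem_filter, hlen, sublist_max_appendBlock hl hB hv]
  rw [hil] at *
  constructor
  · rintro ⟨h1, h2, h3⟩
    have hw := h3 v (.inr ⟨le_rfl, by omega⟩)
    exact ⟨⟨(isOpenGap_appendBlock_of_lt hw).1 h1, by omega, fun x hx => hw.trans (hv3 x hx)⟩, hw⟩
  · rintro ⟨⟨h1, h2, h3⟩, hw⟩
    refine ⟨(isOpenGap_appendBlock_of_lt hw).2 h1, by omega, ?_⟩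
    rintro x (⟨y, hy, rfl⟩ | h)
    · have := h3 y hy
      unfold shiftFrom; split_ifs <;> omega
    · omega

/-- The values to the right of the maximum determine the block: `v` is the least of them and `v + b`
the first value above `v` missing from them. It is missing because a low gap lies strictly below the
older entries to the right of the maximum. -/
theorem appendBlock_injective {l B l' B' : List ℕ} {i b v i' b' v' : ℕ}
    (hl : l.Perm (List.range i)) (hB : B.Perm (List.range b)) (hb : 0 < b) (hv : v ∈ lowGaps l)
    (hl' : l'.Perm (List.range i')) (hB' : B'.Perm (List.range b')) (hb' : 0 < b')
    (hv' : v' ∈ lowGaps l') (h : appendBlock l v B = appendBlock l' v' B') :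
    l = l' ∧ v = v' ∧ B = B' := by
  have hbl := List.perm_range_length hB
  have hil := List.perm_range_length hl
  have hbl' := List.perm_range_length hB'
  have hil' := List.perm_range_length hl'
  have hlen : i + b = i' + b' := by
    have := congrArg List.length h
    simpa [appendBlock, hbl, hil, hbl', hil'] using this
  have key : ∀ x, ((∃ y, List.Sublist [i - 1, y] l ∧ shiftFrom v b y = x) ∨ (v ≤ x ∧ x < v + b)) ↔
      ((∃ y, List.Sublist [i' - 1, y] l' ∧ shiftFrom v' b' y = x) ∨
        (v' ≤ x ∧ x < v' + b')) := by
    intro x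
    rw [← sublist_max_appendBlock hl hB hv, ← sublist_max_appendBlock hl' hB' hv', h, hlen]
  have hv3 := (mem_lowGaps.1 hv).2.2
  have hv3' := (mem_lowGaps.1 hv').2.2
  rw [hil] at hv3
  rw [hil'] at hv3'
  have hnot : ∀ y, List.Sublist [i - 1, y] l → v + b < shiftFrom v b y := by
    intro y hy
    have := hv3 y hy
    unfold shiftFrom; split_ifs <;> omega
  have hnot' : ∀ y, List.Sublist [i' - 1, y] l' → v' + b' < shiftFrom v' b' y := by
    intro y hy
    have := hv3' y hy
    unfold shiftFrom; split_ifs <;> omega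
  have e1 : v' ≤ v := by
    rcases (key v).1 (.inr ⟨le_rfl, by omega⟩) with ⟨y, hy, h⟩ | h
    · have := hnot' y hy; omega
    · omega
  have e2 : v ≤ v' := by
    rcases (key v').2 (.inr ⟨le_rfl, by omega⟩) with ⟨y, hy, h⟩ | h
    · have := hnot y hy; omega
    · omega
  obtain rfl : v = v' := le_antisymm e2 e1
  have f1 : b ≤ b' := by
    by_contra hlt
    rcases (key (v + b')).1 (.inr ⟨by omega, by omega⟩) with ⟨y, hy, h⟩ | h
    · have := hnot' y hy; omega
    · omega
  have f2 : b' ≤ b := by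
    by_contra hlt
    rcases (key (v + b)).2 (.inr ⟨by omega, by omega⟩) with ⟨y, hy, h⟩ | h
    · have := hnot y hy; omega
    · omega
  obtain rfl : b = b' := le_antisymm f1 f2
  unfold appendBlock at h
  rw [hbl, hbl'] at h
  obtain ⟨h1, h2⟩ := List.append_inj h (by simp; omega)
  exact ⟨List.map_injective_iff.2 (shiftFrom_injective _ _) h1, rfl,
    List.map_injective_iff.2 (add_right_injective v) h2⟩

/-! ### Decomposition of `2413`-avoiders. -/

theorem List.eq_filter_append_filter {α : Type*} (p : α → Bool) {l : List α}
    (h : ∀ x y, List.Sublist [x, y] l → p x = false → p y = false) :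
    l = l.filter p ++ l.filter (fun x => !p x) := by
  induction l with
  | nil => rfl
  | cons a l ih =>
    have ih := ih fun x y hs => h x y (hs.cons a)
    cases ha : p a
    · have hall : ∀ y ∈ l, p y = false := fun y hy => h a y (by simpa using hy) ha
      have h1 : l.filter p = [] := by
        rw [List.filter_eq_nil_iff]; intro y hy; simp [hall y hy]
      simp only [List.filter_cons, ha, h1, Bool.not_false]
      rw [h1] at ih
      simpa using ih
    · simp only [List.filter_cons, ha, Bool.not_true]
      simpa using ih

/-- The block consists of the lowest run of consecutive values to the right of the maximum;
avoidance forces it to stand at the very end. -/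
theorem exists_eq_appendBlock {l : List ℕ} {n : ℕ} (hl : l.Perm (List.range (n + 1)))
    (hav : Avoids2413 l) (htop : ¬ ∃ A, l = A ++ [n]) :
    ∃ l' v B i b, l'.Perm (List.range i) ∧ B.Perm (List.range b) ∧ 0 < b ∧ i + b = n + 1 ∧
      v ∈ lowGaps l' ∧ Avoids2413 l' ∧ Avoids2413 B ∧ l = appendBlock l' v B := by
  classical
  have hc := List.perm_range_iff.1 hl
  obtain ⟨A, D, rfl⟩ := List.append_of_mem ((hc.2 n).2 (by omega))
  have hD : D ≠ [] := fun h => htop ⟨A, by rw [h]⟩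
  have hnd := hc.1
  rw [List.nodup_append, List.nodup_cons] at hnd
  obtain ⟨hA, ⟨hnD, hDn⟩, hAD⟩ := hnd
  have hDlt : ∀ x ∈ D, x < n := by
    intro x hx
    have h1 := (hc.2 x).1 (by simp [hx])
    have h2 : x ≠ n := fun h => hnD (h ▸ hx)
    omega
  have hex : ∃ v, v ∈ D := List.exists_mem_of_ne_nil _ hD
  have hvD := Nat.find_spec hex
  have hvmin : ∀ x ∈ D, Nat.find hex ≤ x := fun x hx => Nat.find_min' hex hx
  generalize Nat.find hex = v at hvD hvmin
  have hex2 : ∃ a, v < a ∧ a ∉ D := ⟨n, hDlt v hvD, hnD⟩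
  obtain ⟨hva, haD⟩ := Nat.find_spec hex2
  have hamin : ∀ x, v < x → x < Nat.find hex2 → x ∈ D := fun x h1 h2 => by
    by_contra h
    exact Nat.find_min hex2 h2 ⟨h1, h⟩
  have han : Nat.find hex2 ≤ n := Nat.find_min' hex2 ⟨hDlt v hvD, hnD⟩
  generalize Nat.find hex2 = a at hva haD hamin han
  obtain ⟨b, rfl⟩ := Nat.exists_eq_add_of_le hva.le
  have hDsplit : D = D.filter (fun x => decide (v + b ≤ x)) ++
      D.filter (fun x => !decide (v + b ≤ x)) := by
    refine List.eq_filter_append_filter (fun x => decide (v + b ≤ x)) fun x y hs hx => ?_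
    simp only [decide_eq_false_iff_not, not_le] at hx ⊢
    by_contra hy
    have hyD : y ∈ D := hs.subset (by simp)
    have hyn := hDlt y hyD
    have hne : v + b ≠ y := fun h => haD (h ▸ hyD)
    have haA : v + b ∈ A := by
      have := (hc.2 (v + b)).2 (by omega)
      rcases List.mem_append.1 this with h | h
      · exact h
      · rcases List.mem_cons.1 h with h | h
        · omega
        · exact absurd h haD
    -- A run entry `x` followed by a larger non-run entry `y` would complete `v + b`, `n`, `x`, `y`
    -- to a 2413.
    exact hav x (v + b) y n (quadruple_sublist_append.2 (.inr (.inr (.inr (.inl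
      ⟨haA, hs.cons_cons n⟩))))) hx (by omega) hyn
  set D1 := D.filter (fun x => decide (v + b ≤ x)) with hD1
  set D2 := D.filter (fun x => !decide (v + b ≤ x)) with hD2
  have mD1 : ∀ x, x ∈ D1 ↔ x ∈ D ∧ v + b ≤ x := fun x => by simp [hD1]
  have mD2 : ∀ x, x ∈ D2 ↔ v ≤ x ∧ x < v + b := fun x => by
    simp only [hD2, List.mem_filter, Bool.not_eq_true', decide_eq_false_iff_not, not_le]
    refine ⟨fun h => ⟨hvmin x h.1, h.2⟩, fun h => ⟨?_, h.2⟩⟩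
    rcases h.1.eq_or_lt with h1 | h1
    · exact h1 ▸ hvD
    · exact hamin x h1 h.2
  have hnd2 : (A ++ n :: D1).Nodup := by
    have := hc.1
    rw [hDsplit, ← List.cons_append, ← List.append_assoc, List.nodup_append] at this
    exact this.1
  have mR : ∀ x, x ∈ A ++ n :: D1 ↔ x < n + 1 ∧ ¬ (v ≤ x ∧ x < v + b) := by
    intro x
    have h1 := hc.1
    rw [hDsplit, ← List.cons_append, ← List.append_assoc] at h1
    have h2 : x ∈ (A ++ n :: D1) ++ D2 ↔ x < n + 1 := by
      rw [← hc.2]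
      conv_rhs => rw [hDsplit]
      simp
    rw [List.mem_append] at h2
    rw [← mD2, ← h2]
    have := (List.disjoint_of_nodup_append h1)
    constructor
    · exact fun h => ⟨.inl h, this h⟩
    · exact fun h => h.1.resolve_right h.2
  let un : ℕ → ℕ := fun x => if x < v then x else x - b
  have hun : ∀ x, ¬ (v ≤ x ∧ x < v + b) → shiftFrom v b (un x) = x := by
    intro x hx
    simp only [un, shiftFrom]; split_ifs <;> omega
  let B := D2.map (· - v)
  let l' := (A ++ n :: D1).map un
  have hB : B.Perm (List.range b) := by
    rw [List.perm_range_iff]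
    constructor
    · refine List.Nodup.map_on ?_ (hDn.filter _)
      intro x hx y hy hxy
      have := (mD2 x).1 hx
      have := (mD2 y).1 hy
      omega
    · intro x
      simp only [B, List.mem_map, mD2]
      constructor
      · rintro ⟨y, hy, rfl⟩; omega
      · intro hx; exact ⟨v + x, by omega, by omega⟩
  have hl' : l'.Perm (List.range (n + 1 - b)) := by
    rw [List.perm_range_iff]
    constructor
    · refine List.Nodup.map_on ?_ hnd2
      intro x hx y hy hxy
      rw [← hun x ((mR x).1 hx).2, ← hun y ((mR y).1 hy).2, hxy]
    · intro x
      simp only [l', List.mem_map, mR]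
      constructor
      · rintro ⟨y, hy, rfl⟩
        simp only [un]; split_ifs <;> omega
      · intro hx
        refine ⟨shiftFrom v b x, ?_, ?_⟩ <;> simp only [un, shiftFrom] <;> split_ifs <;> omega
  have hbl := List.perm_range_length hB
  have hll := List.perm_range_length hl'
  have hmapsh : l'.map (shiftFrom v b) = A ++ n :: D1 := by
    simp only [l', List.map_map]
    conv_rhs => rw [← List.map_id (A ++ n :: D1)]
    exact List.map_congr_left fun x hx => hun x ((mR x).1 hx).2
  have heq : A ++ n :: D = appendBlock l' v B := by
    unfold appendBlock
    rw [hbl, hmapsh]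
    conv_lhs => rw [hDsplit]
    have : B.map (v + ·) = D2 := by
      simp only [B, List.map_map]
      conv_rhs => rw [← List.map_id D2]
      refine List.map_congr_left fun x hx => ?_
      have := (mD2 x).1 hx
      simp only [Function.comp_apply, id_eq]; omega
    rw [this]
    simp
  have hav' := hav
  rw [heq, avoids2413_appendBlock hB (by omega)] at hav'
  refine ⟨l', v, B, n + 1 - b, b, hl', hB, by omega, by omega, ?_, hav'.1, hav'.2.1, heq⟩
  rw [mem_lowGaps, hll]
  refine ⟨hav'.2.2, by omega, fun x hx => ?_⟩
  have hx' : List.Sublist [n, shiftFrom v b x] (A ++ n :: D1) := by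
    rw [← hmapsh, pair_sublist_map]
    refine ⟨_, _, hx, ?_, rfl⟩
    unfold shiftFrom; split_ifs <;> omega
  have hmem : shiftFrom v b x ∈ D1 := by
    have hnA : n ∉ A := fun h => hAD n h n (by simp) rfl
    rcases pair_sublist_append.1 hx' with h | h | h
    · exact absurd (h.subset (by simp)) hnA
    · exact absurd h.1 hnA
    · simpa using h
  have h1 := (mD1 _).1 hmem
  have h2 : shiftFrom v b x ≠ v + b := fun h => haD (h ▸ h1.1)
  have h3 := h1.2
  unfold shiftFrom at h2 h3
  split_ifs at h2 h3 <;> omega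

/-! ### Recurrences for the gap polynomials. -/

/-- A geometric sum: as `v` runs upwards through `S`, the exponents are `0, 1, …, S.card - 1`. -/
theorem sum_pow_card_filter_lt {R : Type*} [CommRing R] (u : R) (S : Finset ℕ) :
    (u - 1) * ∑ v ∈ S, u ^ (S.filter (· < v)).card = u ^ S.card - 1 := by
  induction S using Finset.induction_on_max with
  | empty => simp
  | insert a S ha ih =>
    have haS : a ∉ S := fun h => lt_irrefl _ (ha a h)
    rw [Finset.sum_insert haS, Finset.card_insert_of_notMem haS]
    have h1 : (insert a S).filter (· < a) = S := by
      ext x; simp only [Finset.mem_filter, Finset.mem_insert]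
      constructor
      · rintro ⟨rfl | h, h'⟩
        · omega
        · exact h
      · exact fun h => ⟨.inr h, ha x h⟩
    have h2 : ∀ v ∈ S, (insert a S).filter (· < v) = S.filter (· < v) := by
      intro v hv
      ext x; simp only [Finset.mem_filter, Finset.mem_insert]
      have := ha v hv
      constructor
      · rintro ⟨rfl | h, h'⟩
        · omega
        · exact ⟨h, h'⟩
      · exact fun h => ⟨.inr h.1, h.2⟩
    rw [h1, Finset.sum_congr rfl fun v hv => by rw [h2 v hv], mul_add, ih]
    ring

/-- Index set of the permutations of size `n + 1` that do not end with their maximum. -/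
noncomputable def blockIndex (n : ℕ) : Finset (Σ _ : ℕ × ℕ, Σ _ : List ℕ × List ℕ, ℕ) :=
  (Finset.HasAntidiagonal.antidiagonal n).sigma fun p =>
    (permLists Avoids2413 p.1 ×ˢ permLists Avoids2413 (p.2 + 1)).sigma fun q => lowGaps q.1

theorem mem_blockIndex {n : ℕ} {x : Σ _ : ℕ × ℕ, Σ _ : List ℕ × List ℕ, ℕ} :
    x ∈ blockIndex n ↔ x.1.1 + x.1.2 = n ∧
      ((x.2.1.1.Perm (List.range x.1.1) ∧ Avoids2413 x.2.1.1) ∧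
        (x.2.1.2.Perm (List.range (x.1.2 + 1)) ∧ Avoids2413 x.2.1.2)) ∧ x.2.2 ∈ lowGaps x.2.1.1 := by
  simp [blockIndex, mem_permLists]

/-- The block has size `p.2 + 1` because it is nonempty. The two kinds are disjoint, as a block
leaves entries to the right of the maximum. -/
theorem sum_permLists_succ {R : Type*} [AddCommMonoid R] (n : ℕ) (f : List ℕ → R) :
    ∑ l ∈ permLists Avoids2413 (n + 1), f l =
      ∑ l ∈ permLists Avoids2413 n, f (l ++ [n]) +
      ∑ p ∈ Finset.HasAntidiagonal.antidiagonal n, ∑ l ∈ permLists Avoids2413 p.1,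
        ∑ v ∈ lowGaps l, ∑ B ∈ permLists Avoids2413 (p.2 + 1), f (appendBlock l v B) := by
  classical
  have hdec : permLists Avoids2413 (n + 1) = (permLists Avoids2413 n).image (· ++ [n]) ∪
      (blockIndex n).image fun x => appendBlock x.2.1.1 x.2.2 x.2.1.2 := by
    ext l
    simp only [Finset.mem_union, Finset.mem_image, mem_permLists]
    constructor
    · rintro ⟨hl, hav⟩
      by_cases htop : ∃ A, l = A ++ [n]
      · obtain ⟨A, rfl⟩ := htop
        have hA : A.Perm (List.range n) := by
          rw [List.range_succ] at hl
          exact (List.perm_append_right_iff _).1 hl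
        exact .inl ⟨A, ⟨hA, (avoids2413_append_top hA).1 hav⟩, rfl⟩
      · obtain ⟨l', v, B, i, b, h1, h2, h3, h4, h5, h6, h7, h8⟩ :=
          exists_eq_appendBlock hl hav htop
        obtain ⟨j, rfl⟩ : ∃ j, b = j + 1 := ⟨b - 1, by omega⟩
        exact .inr ⟨⟨(i, j), ⟨(l', B), v⟩⟩, mem_blockIndex.2
          ⟨by simp only; omega, ⟨⟨h1, h6⟩, h2, h7⟩, h5⟩, h8.symm⟩
    · rintro (⟨A, ⟨hA, hav⟩, rfl⟩ | ⟨⟨⟨i, j⟩, ⟨⟨l', B⟩, v⟩⟩, hx, rfl⟩)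
      · refine ⟨?_, (avoids2413_append_top hA).2 hav⟩
        rw [List.range_succ]
        exact hA.append_right _
      · obtain ⟨h1, ⟨⟨h2, h3⟩, h4, h5⟩, h6⟩ := mem_blockIndex.1 hx
        simp only at h1 h2 h3 h4 h5 h6 ⊢
        have hv := (mem_lowGaps.1 h6).2.1
        rw [List.perm_range_length h2] at hv
        refine ⟨?_, (avoids2413_appendBlock h4 (by omega)).2 ⟨h3, h5, (mem_lowGaps.1 h6).1⟩⟩
        rw [← h1, add_assoc]
        exact appendBlock_perm h2 h4 hv.le
  rw [hdec, Finset.sum_union, Finset.sum_image, Finset.sum_image]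
  · congr 1
    rw [blockIndex, Finset.sum_sigma]
    refine Finset.sum_congr rfl fun p _ => ?_
    rw [Finset.sum_sigma, Finset.sum_product]
    refine Finset.sum_congr rfl fun l _ => ?_
    rw [Finset.sum_comm]
  · rintro ⟨⟨i, j⟩, ⟨⟨l, B⟩, v⟩⟩ hx ⟨⟨i', j'⟩, ⟨⟨l', B'⟩, v'⟩⟩ hx' h
    obtain ⟨h1, ⟨⟨h2, h3⟩, h4, h5⟩, h6⟩ := mem_blockIndex.1 hx
    obtain ⟨h1', ⟨⟨h2', h3'⟩, h4', h5'⟩, h6'⟩ := mem_blockIndex.1 hx'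
    simp only at *
    obtain ⟨rfl, rfl, rfl⟩ := appendBlock_injective h2 h4 (by omega) h6 h2' h4' (by omega) h6' h
    have e1 := (List.perm_range_length h2).symm.trans (List.perm_range_length h2')
    obtain rfl : i = i' := e1
    obtain rfl : j = j' := by omega
    rfl
  · intro A _ A' _ h
    exact List.append_cancel_right h
  · rw [Finset.disjoint_left]
    simp only [Finset.mem_image, not_exists, not_and, forall_exists_index, and_imp]
    rintro _ A hA rfl ⟨⟨i, j⟩, ⟨⟨l, B⟩, v⟩⟩ hx h
    obtain ⟨h1, ⟨⟨h2, h3⟩, h4, h5⟩, h6⟩ := mem_blockIndex.1 hx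
    simp only at *
    have hA' := (mem_permLists.1 hA).1
    have hv := (mem_lowGaps.1 h6).2.1
    rw [List.perm_range_length h2] at hv
    have hs := (sublist_max_appendBlock (x := v) h2 h4 h6).2 (.inr ⟨le_rfl, by omega⟩)
    rw [h, show i + (j + 1) - 1 = n by omega] at hs
    have hn : n ∉ A := fun h => lt_irrefl _ (((List.perm_range_iff.1 hA').2 n).1 h)
    rcases pair_sublist_append.1 hs with h | h | h
    · exact hn (h.subset (by simp))
    · exact hn h.1
    · simpa using h.length_le

/-- The number of `2413`-avoiders of size `n`, weighted by `u` to the number of open gaps. -/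
noncomputable def openPoly {R : Type*} [CommRing R] (u : R) (n : ℕ) : R :=
  ∑ l ∈ permLists Avoids2413 n, u ^ (openGaps l).card

/-- The number of `2413`-avoiders of size `n`, weighted by `u` to the number of low gaps. -/
noncomputable def lowPoly {R : Type*} [CommRing R] (u : R) (n : ℕ) : R :=
  ∑ l ∈ permLists Avoids2413 n, u ^ (lowGaps l).card

/-- The open-gap count after a block insertion splits into low gaps below `v`, open gaps of `B` and
one, so the sum over `v` is geometric. Keeping the factor `u - 1` avoids division and permits any
ring, in particular power series as weights. -/
theorem openPoly_succ {R : Type*} [CommRing R] (u : R) (n : ℕ) :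
    (u - 1) * openPoly u (n + 1) = (u - 1) * u * openPoly u n +
      ∑ p ∈ Finset.HasAntidiagonal.antidiagonal n, (lowPoly u p.1 - (permLists Avoids2413 p.1).card) * u *
        openPoly u (p.2 + 1) := by
  unfold openPoly
  rw [sum_permLists_succ, mul_add]
  congr 1
  · rw [mul_assoc, Finset.mul_sum _ _ u]
    congr 1
    refine Finset.sum_congr rfl fun l hl => ?_
    rw [card_openGaps_append_top (mem_permLists.1 hl).1]
    ring
  · rw [Finset.mul_sum]
    refine Finset.sum_congr rfl fun p _ => ?_
    rw [lowPoly, Finset.card_eq_sum_ones, Nat.cast_sum, ← Finset.sum_sub_distrib,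
      Finset.sum_mul, Finset.sum_mul, Finset.mul_sum]
    refine Finset.sum_congr rfl fun l hl => ?_
    push_cast
    rw [← sum_pow_card_filter_lt, mul_assoc, mul_assoc, Finset.sum_mul]
    congr 1
    refine Finset.sum_congr rfl fun v hv => ?_
    rw [← mul_assoc, Finset.mul_sum]
    refine Finset.sum_congr rfl fun B hB => ?_
    rw [card_openGaps_appendBlock (mem_permLists.1 hl).1 (mem_permLists.1 hB).1 (by omega) hv]
    ring

theorem lowPoly_succ {R : Type*} [CommRing R] (u : R) (n : ℕ) :
    (u - 1) * lowPoly u (n + 1) = (u - 1) * openPoly u n +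
      ∑ p ∈ Finset.HasAntidiagonal.antidiagonal n, (lowPoly u p.1 - (permLists Avoids2413 p.1).card) *
        ((permLists Avoids2413 (p.2 + 1)).card : R) := by
  conv_lhs => unfold lowPoly
  unfold openPoly
  rw [sum_permLists_succ, mul_add]
  congr 1
  · congr 1
    refine Finset.sum_congr rfl fun l hl => ?_
    rw [lowGaps_append_top (mem_permLists.1 hl).1]
  · rw [Finset.mul_sum]
    refine Finset.sum_congr rfl fun p _ => ?_
    rw [lowPoly, Finset.card_eq_sum_ones (permLists Avoids2413 p.1), Nat.cast_sum,
      ← Finset.sum_sub_distrib, Finset.sum_mul, Finset.mul_sum]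
    refine Finset.sum_congr rfl fun l hl => ?_
    push_cast
    rw [← sum_pow_card_filter_lt, mul_assoc, Finset.sum_mul]
    congr 1
    refine Finset.sum_congr rfl fun v hv => ?_
    rw [Finset.sum_congr rfl fun B hB => by
      rw [lowGaps_appendBlock (mem_permLists.1 hl).1 (mem_permLists.1 hB).1 (by omega) hv],
      Finset.sum_const, nsmul_eq_mul, mul_comm]

theorem permLists_zero {P : List ℕ → Prop} (h : P []) : permLists P 0 = {[]} := by
  ext l
  rw [mem_permLists, Finset.mem_singleton]
  constructor
  · rintro ⟨h1, -⟩; simpa using h1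
  · rintro rfl; exact ⟨by simp, h⟩

theorem avoids2413_nil : Avoids2413 [] := by
  intro a b c d h; simp at h

theorem openPoly_zero {R : Type*} [CommRing R] (u : R) : openPoly u 0 = u := by
  rw [openPoly, permLists_zero avoids2413_nil, Finset.sum_singleton]
  have : openGaps [] = {0} := by
    ext v
    simp [mem_openGaps, IsOpenGap]
  rw [this]; simp

theorem lowPoly_zero {R : Type*} [CommRing R] (u : R) : lowPoly u 0 = 1 := by
  rw [lowPoly, permLists_zero avoids2413_nil, Finset.sum_singleton]
  have : lowGaps [] = ∅ := by
    ext v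
    simp [mem_lowGaps]
  rw [this]; simp

theorem openPoly_one {R : Type*} [CommRing R] (n : ℕ) :
    openPoly (1 : R) n = (permLists Avoids2413 n).card := by
  simp [openPoly]

/-! ### Substituting a power series for the catalytic variable. -/

section Diagonal
open PowerSeries

/-- Both sides run over all quadruples with sum `n`; this is what makes `PowerSeries.diagonal`
multiplicative. -/
theorem sum_antidiagonal_interchange {M : Type*} [AddCommMonoid M] (n : ℕ)
    (f : ℕ → ℕ → ℕ → ℕ → M) :
    ∑ p ∈ Finset.HasAntidiagonal.antidiagonal n, ∑ q ∈ Finset.HasAntidiagonal.antidiagonal p.1,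
      ∑ r ∈ Finset.HasAntidiagonal.antidiagonal p.2, f q.1 q.2 r.1 r.2 =
    ∑ p ∈ Finset.HasAntidiagonal.antidiagonal n, ∑ q ∈ Finset.HasAntidiagonal.antidiagonal p.1,
      ∑ r ∈ Finset.HasAntidiagonal.antidiagonal p.2, f q.1 r.1 q.2 r.2 := by
  simp only [← Finset.sum_product', Finset.sum_sigma']
  refine Finset.sum_nbij' (fun x => ⟨(x.2.1.1 + x.2.2.1, x.2.1.2 + x.2.2.2),
      ((x.2.1.1, x.2.2.1), (x.2.1.2, x.2.2.2))⟩)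
    (fun x => ⟨(x.2.1.1 + x.2.2.1, x.2.1.2 + x.2.2.2),
      ((x.2.1.1, x.2.2.1), (x.2.1.2, x.2.2.2))⟩) ?_ ?_ ?_ ?_ ?_
  · rintro ⟨⟨a, b⟩, ⟨⟨c, d⟩, ⟨e, g⟩⟩⟩ h
    simp at h ⊢; omega
  · rintro ⟨⟨a, b⟩, ⟨⟨c, d⟩, ⟨e, g⟩⟩⟩ h
    simp at h ⊢; omega
  · rintro ⟨⟨a, b⟩, ⟨⟨c, d⟩, ⟨e, g⟩⟩⟩ h
    simp at h
    obtain ⟨-, rfl, rfl⟩ := h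
    rfl
  · rintro ⟨⟨a, b⟩, ⟨⟨c, d⟩, ⟨e, g⟩⟩⟩ h
    simp at h
    obtain ⟨-, rfl, rfl⟩ := h
    rfl
  · rintro ⟨⟨a, b⟩, ⟨⟨c, d⟩, ⟨e, g⟩⟩⟩ h
    rfl

/-- Setting both variables of a power series over power series equal. -/
noncomputable def PowerSeries.diagonal (R : Type*) [CommRing R] : R⟦X⟧⟦X⟧ →+* R⟦X⟧ where
  toFun f := mk fun n => ∑ p ∈ Finset.HasAntidiagonal.antidiagonal n, coeff p.2 (coeff p.1 f)
  map_zero' := by ext; simp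
  map_one' := by
    ext n
    rw [coeff_mk, Finset.sum_eq_single (0, n)]
    · simp
    · rintro ⟨a, b⟩ h hne
      have : a ≠ 0 := by
        rintro rfl
        simp at h; exact hne (by rw [h])
      simp [coeff_one, this]
    · simp
  map_add' f g := by ext n; simp [Finset.sum_add_distrib]
  map_mul' f g := by
    ext n
    simp only [coeff_mul, coeff_mk, map_sum, Finset.sum_mul_sum]
    exact sum_antidiagonal_interchange n fun a b c d => coeff c (coeff a f) * coeff d (coeff b g)

theorem PowerSeries.coeff_diagonal {R : Type*} [CommRing R] (f : R⟦X⟧⟦X⟧) (n : ℕ) :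
    coeff n (diagonal R f) =
      ∑ p ∈ Finset.HasAntidiagonal.antidiagonal n, coeff p.2 (coeff p.1 f) := by
  simp [diagonal]

@[simp] theorem PowerSeries.diagonal_C {R : Type*} [CommRing R] (a : R⟦X⟧) :
    diagonal R (C a) = a := by
  ext n
  rw [coeff_diagonal, Finset.sum_eq_single (0, n)]
  · simp
  · rintro ⟨i, j⟩ h hne
    have : i ≠ 0 := by
      rintro rfl
      simp at h; exact hne (by rw [h])
    simp [coeff_C, this]
  · simp

@[simp] theorem PowerSeries.diagonal_X {R : Type*} [CommRing R] :
    diagonal R X = X := by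
  ext n
  rw [coeff_diagonal]
  rcases n with _ | n
  · simp
  rw [Finset.sum_eq_single (1, n)]
  · simp [coeff_one, coeff_X]
  · rintro ⟨i, j⟩ h hne
    have : i ≠ 1 := by
      rintro rfl
      simp at h; exact hne (by rw [show j = n by omega])
    simp [coeff_X, this]
  · intro h; simp at h; omega

@[simp] theorem PowerSeries.diagonal_map_C {R : Type*} [CommRing R] (a : R⟦X⟧) :
    diagonal R (map C a) = a := by
  ext n
  rw [coeff_diagonal, Finset.sum_eq_single (n, 0)]
  · simp
  · rintro ⟨i, j⟩ h hne
    have : j ≠ 0 := by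
      rintro rfl
      simp at h; exact hne (by rw [h])
    simp [coeff_C, this]
  · simp

theorem PowerSeries.dvd_diagonal {R : Type*} [CommRing R] {f : R⟦X⟧⟦X⟧} {d : R⟦X⟧}
    (h : ∀ n, d ∣ coeff n f) : d ∣ diagonal R f := by
  choose g hg using h
  have : f = C d * mk g := by ext1 n; rw [coeff_C_mul, coeff_mk, hg]
  rw [this, map_mul, diagonal_C]
  exact dvd_mul_right _ _

theorem PowerSeries.coeff_eq_of_X_pow_dvd_sub {R : Type*} [CommRing R] {f g : R⟦X⟧} {k m : ℕ}
    (h : X ^ k ∣ f - g) (hm : m < k) : coeff m f = coeff m g := by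
  have := X_pow_dvd_iff.1 h m hm
  rwa [map_sub, sub_eq_zero] at this

/-- A map on power series that raises the order of agreement has a fixed point. -/
theorem PowerSeries.exists_fixedPoint {R : Type*} [CommRing R] (Φ : R⟦X⟧ → R⟦X⟧)
    (h : ∀ k f g, X ^ k ∣ f - g → X ^ (k + 1) ∣ Φ f - Φ g) : ∃ f, Φ f = f := by
  let s : ℕ → R⟦X⟧ := fun n => Φ^[n] 0
  have hs : ∀ n, s (n + 1) = Φ (s n) := fun n => Function.iterate_succ_apply' Φ n 0
  have h1 : ∀ n, X ^ n ∣ s (n + 1) - s n := by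
    intro n
    induction n with
    | zero => simp
    | succ n ih => rw [hs (n + 1), hs n]; exact h n _ _ (by rw [← hs n]; exact ih)
  have h2 : ∀ n k, X ^ n ∣ s (n + k) - s n := by
    intro n k
    induction k with
    | zero => simp
    | succ k ih =>
      have := dvd_add ((pow_dvd_pow X (Nat.le_add_right n k)).trans (h1 (n + k))) ih
      rwa [sub_add_sub_cancel] at this
  let f : R⟦X⟧ := mk fun n => coeff n (s (n + 1))
  have h3 : ∀ n, X ^ n ∣ f - s n := by
    intro n
    rw [X_pow_dvd_iff]
    intro m hm
    obtain ⟨k, rfl⟩ := Nat.exists_eq_add_of_le (Nat.succ_le_of_lt hm)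
    rw [map_sub, coeff_mk, sub_eq_zero]
    exact (coeff_eq_of_X_pow_dvd_sub (h2 (m + 1) k) (by omega)).symm
  refine ⟨f, ?_⟩
  ext n
  have e1 := h n _ _ (h3 n)
  have e2 := h3 (n + 1)
  rw [← hs] at e1
  exact (coeff_eq_of_X_pow_dvd_sub e1 (by omega)).trans
    (coeff_eq_of_X_pow_dvd_sub e2 (by omega)).symm

theorem PowerSeries.eq_zero_of_forall_X_pow_dvd {R : Type*} [CommRing R] {f : R⟦X⟧}
    (h : ∀ k, X ^ (k + 1) ∣ f) : f = 0 := by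
  ext n
  exact X_pow_dvd_iff.1 (h n) n (by omega)
end Diagonal

/-! ### The functional equation and its solution by the quadratic method. -/

section FunctionalEquation
open PowerSeries

/-- The generating function of the permutations with property `P`. -/
noncomputable def permSeries (P : List ℕ → Prop) (R : Type*) [CommRing R] : R⟦X⟧ :=
  mk fun n => ((permLists P n).card : R)

theorem openSeries_eq {R : Type*} [CommRing R] (u : R) :
    C (u - 1) * (mk (openPoly u) - C u) = C ((u - 1) * u) * X * mk (openPoly u) +
      (mk (lowPoly u) - permSeries Avoids2413 R) * C u * (mk (openPoly u) - C u) := by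
  ext n
  cases n with
  | zero => simp [openPoly_zero, permSeries, lowPoly_zero, permLists_zero avoids2413_nil]
  | succ n =>
    have hF : mk (openPoly u) - C u = X * mk fun n => openPoly u (n + 1) := by
      ext m
      cases m with
      | zero => simp [openPoly_zero]
      | succ m => simp [coeff_succ_X_mul]
    rw [hF, mul_left_comm, mul_left_comm _ X, mul_assoc _ X, mul_left_comm _ X, map_add,
      coeff_succ_X_mul, coeff_succ_X_mul, coeff_succ_X_mul, coeff_C_mul, coeff_C_mul, coeff_mul,
      coeff_mk, coeff_mk, openPoly_succ]
    simp [permSeries]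

theorem lowSeries_eq {R : Type*} [CommRing R] (u : R) :
    C (u - 1) * (mk (lowPoly u) - 1) = C (u - 1) * X * mk (openPoly u) +
      (mk (lowPoly u) - permSeries Avoids2413 R) * (permSeries Avoids2413 R - 1) := by
  ext n
  cases n with
  | zero => simp [permSeries, lowPoly_zero, permLists_zero avoids2413_nil]
  | succ n =>
    have hF : mk (lowPoly u) - 1 = X * mk fun n => lowPoly u (n + 1) := by
      ext m
      cases m with
      | zero => simp [lowPoly_zero]
      | succ m => simp [coeff_succ_X_mul, coeff_one]
    have hC : permSeries Avoids2413 R - 1 =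
        X * mk fun n => ((permLists Avoids2413 (n + 1)).card : R) := by
      ext m
      cases m with
      | zero => simp [permSeries, permLists_zero avoids2413_nil]
      | succ m => simp [coeff_succ_X_mul, coeff_one, permSeries]
    rw [hF, hC, mul_left_comm, mul_left_comm _ X, mul_assoc _ X, mul_left_comm _ X, map_add,
      coeff_succ_X_mul, coeff_succ_X_mul, coeff_succ_X_mul, coeff_C_mul, coeff_C_mul, coeff_mul,
      coeff_mk, coeff_mk, lowPoly_succ]
    simp [permSeries]

/-- The generating function of `2413`-avoiders, with a series substituted for the weight of an
open gap. -/
noncomputable def openSeries (U : ℚ⟦X⟧) : ℚ⟦X⟧ := diagonal ℚ (mk (openPoly U))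

theorem diagonal_permSeries (P : List ℕ → Prop) :
    diagonal ℚ (permSeries P ℚ⟦X⟧) = permSeries P ℚ := by
  rw [← diagonal_map_C (permSeries P ℚ)]
  congr 1

theorem constantCoeff_permSeries : constantCoeff (permSeries Avoids2413 ℚ) = 1 := by
  simp [permSeries, permLists_zero avoids2413_nil]

theorem openSeries_one : openSeries 1 = permSeries Avoids2413 ℚ := by
  rw [openSeries, ← diagonal_permSeries]
  congr 1
  ext1 n
  simp [permSeries, openPoly_one]

/-- Eliminating the low-gap series from the two linear relations yields this equation times `U - 1`.
That factor can be cancelled unless `U = 1`, where the open-gap series is the plain generating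
function and the equation is immediate. -/
theorem openSeries_quadratic (U : ℚ⟦X⟧) :
    X * U * openSeries U ^ 2 + permSeries Avoids2413 ℚ * (1 - U - X * U) * openSeries U +
      U * permSeries Avoids2413 ℚ * (U - 1) = 0 := by
  by_cases hU : U = 1
  · subst hU
    rw [openSeries_one]; ring
  have e1 := congrArg (diagonal ℚ) (openSeries_eq U)
  have e2 := congrArg (diagonal ℚ) (lowSeries_eq U)
  simp only [map_mul, map_add, map_sub, map_one, diagonal_C, diagonal_X,
    diagonal_permSeries] at e1 e2
  change (U - 1) * (openSeries U - U) = (U - 1) * U * X * openSeries U +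
    (_ - permSeries Avoids2413 ℚ) * U * (openSeries U - U) at e1
  change _ = (U - 1) * X * openSeries U + _ at e2
  generalize openSeries U = y at *
  generalize permSeries Avoids2413 ℚ = c at *
  generalize (diagonal ℚ) (mk (lowPoly U)) = W at *
  refine mul_left_cancel₀ (sub_ne_zero.2 hU) ?_
  linear_combination (-(U - c)) * e1 - U * (y - U) * e2

/-- The coefficients are polynomials in the weight. The divisibility gives the contraction behind
the choice of `U` and serves as difference quotient in place of a derivative in `U`. -/
theorem openSeries_sub_dvd {U V : ℚ⟦X⟧} {d : ℚ⟦X⟧} (h : d ∣ U - V) :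
    d ∣ openSeries U - openSeries V := by
  unfold openSeries
  rw [← map_sub]
  refine dvd_diagonal fun n => ?_
  rw [map_sub, coeff_mk, coeff_mk, openPoly, openPoly, ← Finset.sum_sub_distrib]
  exact Finset.dvd_sum fun l _ => h.trans (sub_dvd_pow_sub_pow _ _ _)

/-- The generating function of `2413`-avoiders is parametrised by the root `U` of
`(1 + X) U² - 3 U + 2 = 0` with constant term `1`. -/
theorem exists_parametrization : ∃ U : ℚ⟦X⟧, constantCoeff U = 1 ∧
    (1 + X) * U ^ 2 - 3 * U + 2 = 0 ∧
    permSeries Avoids2413 ℚ * (U + X * U - 1) = 2 * X * U ^ 3 := by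
  set c := permSeries Avoids2413 ℚ with hc
  have hc0 : constantCoeff c ≠ 0 := by rw [hc, constantCoeff_permSeries]; exact one_ne_zero
  have hcc : c * c⁻¹ = 1 := PowerSeries.mul_inv_cancel c hc0
  have hcne : c ≠ 0 := fun h => hc0 (by rw [h, map_zero])
  -- The fixed-point equation is the vanishing of the derivative of the quadratic in the unknown
  -- `openSeries U`, divided by `c` and solved for `U`.
  obtain ⟨U, hU⟩ := exists_fixedPoint
    (fun U => 1 - X * U + 2 * X * U * openSeries U * c⁻¹) (by
      intro k f g hfg
      obtain ⟨p, hp⟩ := hfg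
      obtain ⟨q, hq⟩ := openSeries_sub_dvd (d := X ^ k) (U := f) (V := g) ⟨p, hp⟩
      refine ⟨-p + 2 * c⁻¹ * (p * openSeries f + g * q), ?_⟩
      rw [pow_succ]
      linear_combination (-X + 2 * X * c⁻¹ * openSeries f) * hp + (2 * X * c⁻¹ * g) * hq)
  have hU0 : constantCoeff U = 1 := by
    rw [← hU]; simp
  have hQy : 2 * X * U * openSeries U + c * (1 - U - X * U) = 0 := by
    linear_combination c * hU - 2 * X * U * openSeries U * hcc
  have hQ := openSeries_quadratic U
  -- The partial derivative of the quadratic in `U`. Comparing the equation at `U` and at `U + t`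
  -- with `t = X ^ (k + 1)`, the change of `openSeries` contributes only in second order by `hQy`,
  -- so this expression is divisible by `t` for every `k`.
  have hQu : X * openSeries U ^ 2 - c * (1 + X) * openSeries U + c * (2 * U - 1) = 0 := by
    refine eq_zero_of_forall_X_pow_dvd fun k => ?_
    obtain ⟨q, hq⟩ := openSeries_sub_dvd (d := X ^ (k + 1)) (U := U + X ^ (k + 1)) (V := U)
      ⟨1, by ring⟩
    have hV := openSeries_quadratic (U + X ^ (k + 1))
    rw [sub_eq_iff_eq_add] at hq
    rw [hq] at hV
    rw [← hc] at hV hQ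
    have hX : (X : ℚ⟦X⟧) ^ (k + 1) ≠ 0 := pow_ne_zero _ X_ne_zero
    generalize (X : ℚ⟦X⟧) ^ (k + 1) = t at *
    generalize openSeries U = y at *
    refine ⟨-(X * U * q ^ 2 + 2 * X * y * q + X * q ^ 2 * t - c * (1 + X) * q + c), ?_⟩
    refine mul_left_cancel₀ hX ?_
    linear_combination hV - hQ - t * q * hQy
  have hy : openSeries U = U ^ 2 := by
    refine mul_left_cancel₀ hcne ?_
    rw [← hc] at hQ
    linear_combination hQ - U * hQu
  rw [hy] at hQy hQu
  refine ⟨U, hU0, ?_, by linear_combination -hQy⟩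
  refine mul_left_cancel₀ hcne ?_
  linear_combination U * hQy - 2 * hQu
end FunctionalEquation

/-! ### Extracting coefficients: ballot numbers and central binomials. -/

section Coefficients
open PowerSeries

/-- Ballot numbers as differences of binomial coefficients. -/
def ballot (j : ℕ) : ℕ → ℚ
  | 0 => 1
  | m + 1 => ((2 * (m + 1) + j).choose (m + 1) : ℚ) - (2 * (m + 1) + j).choose m

/-- Pascal's rule; it matches `c ^ (j + 2) = c ^ (j + 1) + X * c ^ (j + 3)` for the Catalan series
`c`. -/
theorem ballot_succ (j m : ℕ) : ballot (j + 1) (m + 1) = ballot j (m + 1) + ballot (j + 2) m := by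
  cases m with
  | zero => simp [ballot]; ring
  | succ m =>
    simp only [ballot]
    have h1 := Nat.choose_succ_succ (2 * (m + 2) + j) (m + 1)
    have h2 := Nat.choose_succ_succ (2 * (m + 2) + j) m
    rw [show 2 * (m + 1 + 1) + (j + 1) = (2 * (m + 2) + j) + 1 by ring, h1, h2,
      show 2 * (m + 1) + (j + 2) = 2 * (m + 2) + j by ring]
    push_cast
    simp only [Nat.succ_eq_add_one]
    ring

theorem ballot_zero_eq_catalan (m : ℕ) : ballot 0 m = catalan m := by
  cases m with
  | zero => simp [ballot]
  | succ m =>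
    have h1 : ((m : ℚ) + 2) * catalan (m + 1) = (2 * (m + 1)).choose (m + 1) := by
      have := succ_mul_catalan_eq_centralBinom (m + 1)
      rw [Nat.centralBinom] at this
      rw [← this]; push_cast; ring
    have h2 : ((2 * (m + 1)).choose (m + 1) : ℚ) * (m + 1) = (2 * (m + 1)).choose m * (m + 2) := by
      have := Nat.choose_succ_right_eq (2 * (m + 1)) m
      rw [show 2 * (m + 1) - m = m + 2 by omega] at this
      exact_mod_cast this
    simp only [ballot, add_zero]
    have h3 : ((m : ℚ) + 2) ≠ 0 := by positivity
    refine mul_left_cancel₀ h3 ?_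
    linear_combination -h1 + h2

theorem ballot_eq (n k : ℕ) (hk : k < n) :
    ballot (n - 1 - k) k = ((n : ℚ) - k) / n * ((n - 1 + k).choose k : ℚ) := by
  have hn : (n : ℚ) ≠ 0 := by
    have : n ≠ 0 := by omega
    exact_mod_cast this
  cases k with
  | zero => simp [ballot, hn]
  | succ m =>
    simp only [ballot]
    rw [show 2 * (m + 1) + (n - 1 - (m + 1)) = n - 1 + (m + 1) by omega]
    have h2 : ((n - 1 + (m + 1)).choose (m + 1) : ℚ) * (m + 1) =
        (n - 1 + (m + 1)).choose m * n := by
      have := Nat.choose_succ_right_eq (n - 1 + (m + 1)) m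
      rw [show n - 1 + (m + 1) - m = n by omega] at this
      exact_mod_cast this
    field_simp
    push_cast
    linear_combination h2

theorem catalanSeries_rat_eq : map (Nat.castRingHom ℚ) catalanSeries =
    1 + X * map (Nat.castRingHom ℚ) catalanSeries ^ 2 := by
  conv_lhs => rw [← catalanSeries_sq_mul_X_add_one]
  simp only [map_add, map_mul, map_pow, map_one, map_X]
  ring

theorem mk_ballot_eq_pow (j : ℕ) :
    mk (ballot j) = map (Nat.castRingHom ℚ) catalanSeries ^ (j + 1) := by
  have h0 : mk (ballot 0) = map (Nat.castRingHom ℚ) catalanSeries := by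
    ext m; simp [ballot_zero_eq_catalan]
  have hrec : ∀ j, mk (ballot (j + 1)) = mk (ballot j) + X * mk (ballot (j + 2)) := by
    intro j
    ext m
    cases m with
    | zero => simp [ballot]
    | succ m => simp [coeff_succ_X_mul, ballot_succ]
  have h1 : mk (ballot 0) = 1 + X * mk (ballot 1) := by
    ext m
    cases m with
    | zero => simp [ballot]
    | succ m =>
      cases m with
      | zero => norm_num [ballot, coeff_succ_X_mul, coeff_one]
      | succ m =>
        simp only [coeff_mk, map_add, coeff_succ_X_mul, coeff_one, ballot]
        have e1 := Nat.choose_succ_succ (2 * (m + 1) + 1) (m + 1)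
        have e2 := Nat.choose_succ_succ (2 * (m + 1) + 1) m
        have e4 : (2 * (m + 1) + 1).choose (m + 1 + 1) = (2 * (m + 1) + 1).choose (m + 1) :=
          Nat.choose_symm_of_eq_add (by ring)
        rw [show 2 * (m + 1 + 1) + 0 = 2 * (m + 1) + 1 + 1 by ring, e1, e2]
        simp only [Nat.succ_eq_add_one, e4]
        push_cast
        simp
  have hc := catalanSeries_rat_eq
  generalize map (Nat.castRingHom ℚ) catalanSeries = c at *
  suffices h : mk (ballot j) = c ^ (j + 1) ∧ mk (ballot (j + 1)) = c ^ (j + 2) from h.1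
  induction j with
  | zero =>
    refine ⟨by rw [h0]; ring, mul_left_cancel₀ (X_ne_zero (R := ℚ)) ?_⟩
    rw [h0] at h1
    linear_combination -h1 + hc
  | succ j ih =>
    refine ⟨ih.2, mul_left_cancel₀ (X_ne_zero (R := ℚ)) ?_⟩
    have := hrec j
    rw [ih.1, ih.2] at this
    linear_combination -this + c ^ (j + 1) * hc

/-- The difference of the equations has the factor `(1 + X) * (U + V) - 3`, whose constant term is
`-1`. -/
theorem eq_of_quadratic {U V : ℚ⟦X⟧} (hU0 : constantCoeff U = 1) (hV0 : constantCoeff V = 1)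
    (hU : (1 + X) * U ^ 2 - 3 * U + 2 = 0) (hV : (1 + X) * V ^ 2 - 3 * V + 2 = 0) : U = V := by
  have h : (U - V) * ((1 + X) * (U + V) - 3) = 0 := by linear_combination hU - hV
  rcases mul_eq_zero.1 h with h | h
  · exact sub_eq_zero.1 h
  · have := congrArg constantCoeff h
    have h3 : constantCoeff (3 : ℚ⟦X⟧) = 3 := map_ofNat constantCoeff 3
    simp [hU0, hV0, h3] at this
    norm_num at this

theorem coeff_of_quadratic {U : ℚ⟦X⟧} (hU0 : constantCoeff U = 1)
    (hU : (1 + X) * U ^ 2 - 3 * U + 2 = 0) {n : ℕ} (hn : 1 ≤ n) :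
    coeff n U = ∑ k ∈ Finset.range n,
      (((n : ℚ) - (k : ℚ)) / (n : ℚ)) * (Nat.choose (n - 1 + k) k : ℚ) * 2 ^ k := by
  set c := rescale (2 : ℚ) (map (Nat.castRingHom ℚ) catalanSeries) with hcdef
  have hc : c = 1 + 2 * X * c ^ 2 := by
    have := congrArg (rescale (2 : ℚ)) catalanSeries_rat_eq
    rw [map_add, map_mul, map_one, map_pow, rescale_X] at this
    rw [← hcdef] at this
    conv_lhs => rw [this]
    rw [map_ofNat C 2]
  have hw0 : constantCoeff (1 - X * c) ≠ 0 := by simp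
  set V := (1 - X * c)⁻¹ with hV
  have hVw : V * (1 - X * c) = 1 := PowerSeries.inv_mul_cancel _ hw0
  have hUV : U = V := by
    refine eq_of_quadratic hU0 (by rw [hV]; simp) hU ?_
    linear_combination -(X * V ^ 2) * hc + (3 * V - 2 * (V * (1 - X * c) + 1)) * hVw
  -- In the geometric series only the powers `(X * c) ^ j` with `1 ≤ j ≤ n` reach the coefficient of
  -- `X ^ n`; the summation index of the claim is `k = n - j`.
  have hgeo : V = ∑ j ∈ Finset.range (n + 1), (X * c) ^ j + (X * c) ^ (n + 1) * V := by
    have := mul_neg_geom_sum (X * c) (n + 1)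
    linear_combination (-V) * this + (∑ j ∈ Finset.range (n + 1), (X * c) ^ j) * hVw
  have hlast : coeff n ((X * c) ^ (n + 1) * V) = 0 := by
    rw [mul_pow, mul_assoc, coeff_X_pow_mul', if_neg (by omega)]
  rw [hUV, hgeo, map_add, map_sum, Finset.sum_range_succ', hlast, add_zero, pow_zero, coeff_one, if_neg (by omega),
    add_zero, ← Finset.sum_range_reflect]
  refine Finset.sum_congr rfl fun k hk => ?_
  have hk' := Finset.mem_range.1 hk
  rw [mul_pow, coeff_X_pow_mul', if_pos (by omega), hcdef, ← map_pow, coeff_rescale,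
    ← mk_ballot_eq_pow, coeff_mk, show n - (n - 1 - k + 1) = k by omega, ballot_eq n k hk']
  ring

/-- With `c = U² (2 - U)` one gets `c' = U⁴`, while `X U⁴ = c (U - 1)`; hence the logarithmic
derivative `X c' / c` is `U - 1`. -/
theorem coeff_of_mul_permSeries_avoids2413 {A : ℚ⟦X⟧}
    (hA : A * permSeries Avoids2413 ℚ = X * d⁄dX ℚ (permSeries Avoids2413 ℚ)) {n : ℕ}
    (hn : 1 ≤ n) :
    coeff n A = ∑ k ∈ Finset.range n,
      (((n : ℚ) - (k : ℚ)) / (n : ℚ)) * (Nat.choose (n - 1 + k) k : ℚ) * 2 ^ k := by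
  obtain ⟨U, hU0, hU, hUc⟩ := exists_parametrization
  rw [← coeff_of_quadratic hU0 hU hn]
  have hc0 := constantCoeff_permSeries
  generalize permSeries Avoids2413 ℚ = c at *
  have hcne : c ≠ 0 := by rintro rfl; simp at hc0
  have hU1 : U - 1 ≠ 0 := by
    intro h
    rw [sub_eq_zero.1 h] at hU
    have h1 : (X : ℚ⟦X⟧) = 0 := by linear_combination hU
    exact X_ne_zero h1
  have h1 : c * (U - 1) = X * U ^ 4 := by
    have : (2 : ℚ⟦X⟧) ≠ 0 := by
      intro h
      have := congrArg constantCoeff h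
      rw [map_ofNat constantCoeff 2, map_zero] at this
      norm_num at this
    refine mul_left_cancel₀ this ?_
    linear_combination U * hUc - c * hU
  have h2 : c = U ^ 2 * (2 - U) := by
    refine mul_right_cancel₀ hU1 ?_
    linear_combination h1 + U ^ 2 * hU
  have hdU : (d⁄dX ℚ U) * (4 - 3 * U) = U ^ 3 := by
    have := congrArg (d⁄dX ℚ) hU
    have h3 : d⁄dX ℚ (3 : ℚ⟦X⟧) = 0 := by
      rw [show (3 : ℚ⟦X⟧) = C 3 from (map_ofNat C 3).symm, derivative_C]
    have h22 : d⁄dX ℚ (2 : ℚ⟦X⟧) = 0 := by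
      rw [show (2 : ℚ⟦X⟧) = C 2 from (map_ofNat C 2).symm, derivative_C]
    simp only [map_add, map_sub, Derivation.leibniz, derivative_pow, derivative_X,
      derivative_one, h3, h22, smul_eq_mul, map_zero, Nat.cast_ofNat] at this
    linear_combination (-U) * this + 2 * d⁄dX ℚ U * hU
  have hdc : d⁄dX ℚ c = d⁄dX ℚ U * U * (4 - 3 * U) := by
    have h22 : d⁄dX ℚ (2 : ℚ⟦X⟧) = 0 := by
      rw [show (2 : ℚ⟦X⟧) = C 2 from (map_ofNat C 2).symm, derivative_C]
    rw [h2]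
    simp only [map_sub, Derivation.leibniz, derivative_pow, h22, smul_eq_mul, Nat.cast_ofNat]
    ring
  have hA' : A = U - 1 := by
    refine mul_right_cancel₀ hcne ?_
    rw [hA, hdc]
    linear_combination X * U * hdU - h1
  rw [hA', map_sub, coeff_one, if_neg (by omega), sub_zero]

theorem coeff_of_mul_catalanSeries {A c : ℚ⟦X⟧} (hc : c = 1 + X * c ^ 2)
    (hA : A * c = X * d⁄dX ℚ c) {n : ℕ} (hn : 1 ≤ n) :
    coeff n A = (2 * n - 1).choose n := by
  set B : ℚ⟦X⟧ := mk fun n => (n.centralBinom : ℚ) with hB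
  have hc0 : constantCoeff c = 1 := by rw [hc]; simp
  have hcne : c ≠ 0 := by rintro rfl; simp at hc0
  have hdB : (1 - 4 * X) * d⁄dX ℚ B = 2 * B := by
    ext m
    rw [sub_mul, one_mul, mul_assoc, map_sub, show (4 : ℚ⟦X⟧) = C 4 from (map_ofNat C 4).symm,
      show (2 : ℚ⟦X⟧) = C 2 from (map_ofNat C 2).symm, coeff_C_mul, coeff_C_mul]
    have key : ∀ m : ℕ, ((m : ℚ) + 1) * (m + 1).centralBinom = 2 * (2 * m + 1) * m.centralBinom :=
      fun m => mod_cast Nat.succ_mul_centralBinom_succ m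
    cases m with
    | zero =>
      have := key 0
      simpa [coeff_derivative, hB] using this
    | succ m =>
      rw [coeff_succ_X_mul, coeff_derivative, coeff_derivative, hB, coeff_mk, coeff_mk]
      have := key (m + 1)
      push_cast at this ⊢
      linear_combination this
  have hdc : d⁄dX ℚ c * (1 - 2 * X * c) = c ^ 2 := by
    have := congrArg (d⁄dX ℚ) hc
    simp only [map_add, Derivation.leibniz, derivative_pow, derivative_X,
      derivative_one, smul_eq_mul, Nat.cast_ofNat] at this
    linear_combination this
  have hE2 : (1 - 2 * X * c) ^ 2 = 1 - 4 * X := by linear_combination (-4 * X) * hc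
  have hE0 : constantCoeff (1 - 2 * X * c) = 1 := by simp
  have hEne : 1 - 2 * X * c ≠ 0 := by
    intro h; rw [h] at hE0; simp at hE0
  -- `1 - 2 * X * c` is the square root of `1 - 4 * X`; the product has derivative 0 and constant
  -- term 1.
  have hBE : B * (1 - 2 * X * c) = 1 := by
    refine derivative.ext ?_ (by simp [hB])
    have h22 : d⁄dX ℚ (2 : ℚ⟦X⟧) = 0 := by
      rw [show (2 : ℚ⟦X⟧) = C 2 from (map_ofNat C 2).symm, derivative_C]
    simp only [map_sub, Derivation.leibniz, derivative_X, derivative_one, h22, smul_eq_mul]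
    refine mul_left_cancel₀ (pow_ne_zero 2 hEne) ?_
    rw [← hE2] at hdB
    linear_combination (1 - 2 * X * c) * hdB - 2 * X * B * (1 - 2 * X * c) * hdc -
      2 * B * (1 - 2 * X * c) * hc
  have hA' : 2 * A = B - 1 := by
    refine mul_right_cancel₀ hcne (mul_right_cancel₀ hEne ?_)
    linear_combination 2 * (1 - 2 * X * c) * hA + 2 * X * hdc - c * hBE
  have := congrArg (coeff n) hA'
  rw [show (2 : ℚ⟦X⟧) = C 2 from (map_ofNat C 2).symm, coeff_C_mul, map_sub, coeff_one,
    if_neg (by omega), sub_zero, hB, coeff_mk] at this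
  have h2 : (n.centralBinom : ℚ) = 2 * (2 * n - 1).choose n := by
    obtain ⟨m, rfl⟩ : ∃ m, n = m + 1 := ⟨n - 1, by omega⟩
    rw [Nat.centralBinom_eq_two_mul_choose, show 2 * (m + 1) = 2 * m + 1 + 1 by ring,
      Nat.choose_succ_succ, Nat.succ_eq_add_one, Nat.add_sub_cancel,
      Nat.choose_symm_of_eq_add (show 2 * m + 1 = m + (m + 1) by ring)]
    push_cast; ring
  linarith
end Coefficients

/-! ### Direct sums of permutations. -/

theorem List.perm_range_length_of_lower {X : List ℕ} (hX : X.Nodup)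
    (h : ∀ x ∈ X, ∀ z < x, z ∈ X) : X.Perm (List.range X.length) := by
  rw [List.perm_range_iff]
  refine ⟨hX, fun x => ?_⟩
  have hcard : X.toFinset.card = X.length := List.toFinset_card_of_nodup hX
  constructor
  · intro hx
    have hsub : Finset.range (x + 1) ⊆ X.toFinset := by
      intro z hz
      rw [List.mem_toFinset]
      rcases (Nat.lt_succ_iff.1 (Finset.mem_range.1 hz)).lt_or_eq with h1 | h1
      · exact h x hx z h1
      · exact h1 ▸ hx
    have := Finset.card_le_card hsub
    rw [Finset.card_range, hcard] at this
    exact this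
  · intro hx
    by_contra hn
    have hsub : X.toFinset ⊆ Finset.range x := by
      intro y hy
      rw [List.mem_toFinset] at hy
      rw [Finset.mem_range]
      by_contra hxy
      rcases (not_lt.1 hxy).lt_or_eq with h1 | h1
      · exact hn (h y hy x h1)
      · exact hn (h1 ▸ hy)
    have := Finset.card_le_card hsub
    rw [Finset.card_range, hcard] at this
    omega

theorem List.Perm.append_map_add {X Y : List ℕ} {i j : ℕ} (hX : X.Perm (List.range i))
    (hY : Y.Perm (List.range j)) : (X ++ Y.map (i + ·)).Perm (List.range (i + j)) := by
  rw [List.range_add]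
  exact hX.append (hY.map _)

theorem List.perm_range_of_append {X Y : List ℕ} {n : ℕ} (h : (X ++ Y).Perm (List.range n))
    (hlt : ∀ x ∈ X, ∀ y ∈ Y, x < y) :
    X.Perm (List.range X.length) ∧
      ∃ Y' : List ℕ, Y'.Perm (List.range Y.length) ∧ Y = Y'.map (X.length + ·) := by
  obtain ⟨hnd, hm⟩ := List.perm_range_iff.1 h
  have hn := List.perm_range_length h
  rw [List.length_append] at hn
  rw [List.nodup_append] at hnd
  have hX : X.Perm (List.range X.length) := by
    refine List.perm_range_length_of_lower hnd.1 fun x hx z hz => ?_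
    have hz' := (hm z).2 (hz.trans ((hm x).1 (List.mem_append_left _ hx)))
    rcases List.mem_append.1 hz' with h | h
    · exact h
    · exact absurd (hlt x hx z h) (by omega)
  have hmX := (List.perm_range_iff.1 hX).2
  have hmY : ∀ y, y ∈ Y ↔ X.length ≤ y ∧ y < n := by
    intro y
    constructor
    · intro hy
      refine ⟨?_, (hm y).1 (List.mem_append_right _ hy)⟩
      by_contra hlt'
      exact lt_irrefl _ (hlt y ((hmX y).2 (not_le.1 hlt')) y hy)
    · rintro ⟨h1, h2⟩
      rcases List.mem_append.1 ((hm y).2 h2) with h | h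
      · exact absurd ((hmX y).1 h) (by omega)
      · exact h
  refine ⟨hX, Y.map (· - X.length), ?_, ?_⟩
  · rw [List.perm_range_iff]
    constructor
    · refine List.Nodup.map_on (fun x hx y hy hxy => ?_) hnd.2.1
      have := (hmY x).1 hx
      have := (hmY y).1 hy
      omega
    · intro x
      simp only [List.mem_map, hmY]
      constructor
      · rintro ⟨y, hy, rfl⟩; omega
      · intro hx; exact ⟨X.length + x, by omega, by omega⟩
  · rw [List.map_map]
    conv_lhs => rw [← List.map_id Y]
    refine List.map_congr_left fun y hy => ?_
    have := (hmY y).1 hy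
    simp only [Function.comp_apply, id_eq]; omega

/-- A property of permutations that holds for a direct sum iff it holds for the summands. -/
def IsSumClosed (P : List ℕ → Prop) : Prop :=
  ∀ ⦃X Y : List ℕ⦄ ⦃i j : ℕ⦄, X.Perm (List.range i) → Y.Perm (List.range j) →
    (P (X ++ Y.map (i + ·)) ↔ P X ∧ P Y)

theorem isSumClosed_avoids231 : IsSumClosed Avoids231 := by
  intro X Y i j hX hY
  have hmX := (List.perm_range_iff.1 hX).2
  constructor
  · intro h
    exact ⟨fun a b c hs => h a b c (triple_sublist_append.2 (.inl hs)), fun a b c hs h1 h2 =>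
      h _ _ _ (triple_sublist_append.2 (.inr (.inr (.inr (triple_sublist_map.2
        ⟨_, _, _, hs, rfl, rfl, rfl⟩))))) (by omega) (by omega)⟩
  · rintro ⟨h, h'⟩ a b c hs h1 h2
    rcases triple_sublist_append.1 hs with hs | ⟨hm, ha⟩ | ⟨hb, hs⟩ | hs
    · exact h a b c hs h1 h2
    · obtain ⟨y, -, rfl⟩ := List.mem_map.1 ha
      have := (hmX b).1 (hm.subset (by simp))
      omega
    · obtain ⟨y, -, rfl⟩ := List.mem_map.1 (hs.subset (by simp : a ∈ [c, a]))
      have := (hmX b).1 hb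
      omega
    · obtain ⟨b', c', a', hm, rfl, rfl, rfl⟩ := triple_sublist_map.1 hs
      exact h' _ _ _ hm (by omega) (by omega)

theorem isSumClosed_avoids2413 : IsSumClosed Avoids2413 := by
  intro X Y i j hX hY
  have hmX := (List.perm_range_iff.1 hX).2
  constructor
  · intro h
    exact ⟨fun a b c d hs => h a b c d (quadruple_sublist_append.2 (.inl hs)),
      fun a b c d hs h1 h2 h3 => h _ _ _ _ (quadruple_sublist_append.2 (.inr (.inr (.inr (.inr
        (quadruple_sublist_map.2 ⟨_, _, _, _, hs, rfl, rfl, rfl, rfl⟩)))))) (by omega) (by omega)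
        (by omega)⟩
  · rintro ⟨h, h'⟩ a b c d hs h1 h2 h3
    rcases quadruple_sublist_append.1 hs with hs | ⟨hm, hc⟩ | ⟨hm, hs'⟩ | ⟨hb, hs⟩ | hs
    · exact h a b c d hs h1 h2 h3
    · obtain ⟨y, -, rfl⟩ := List.mem_map.1 hc
      have := (hmX d).1 (hm.subset (by simp))
      omega
    · obtain ⟨y, -, rfl⟩ := List.mem_map.1 (hs'.subset (by simp : a ∈ [a, c]))
      have := (hmX b).1 (hm.subset (by simp))
      omega
    · obtain ⟨y, -, rfl⟩ := List.mem_map.1 (hs.subset (by simp : a ∈ [d, a, c]))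
      have := (hmX b).1 hb
      omega
    · obtain ⟨b', d', a', c', hm, rfl, rfl, rfl, rfl⟩ := quadruple_sublist_map.1 hs
      exact h' _ _ _ _ hm (by omega) (by omega) (by omega)

/-! ### The Catalan recursion for `231`-avoiders. -/

theorem avoids231_cons_top {D : List ℕ} {j : ℕ} (hD : D.Perm (List.range j)) :
    Avoids231 (j :: D) ↔ Avoids231 D := by
  have hm := (List.perm_range_iff.1 hD).2
  constructor
  · exact fun h a b c hs => h a b c (hs.cons _)
  · intro h a b c hs h1 h2
    rw [List.sublist_cons_iff] at hs
    rcases hs with hs | ⟨r, hr, hs⟩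
    · exact h a b c hs h1 h2
    · simp only [List.cons.injEq] at hr
      obtain ⟨rfl, rfl⟩ := hr
      have := (hm c).1 (hs.subset (by simp))
      omega

/-- Every entry left of the maximum is smaller than every entry right of it, as otherwise the
maximum completes a 231. So an avoider is the direct sum of an avoider and an avoider headed by its
maximum. -/
theorem card_permLists_avoids231_succ (n : ℕ) :
    (permLists Avoids231 (n + 1)).card = ∑ p ∈ Finset.HasAntidiagonal.antidiagonal n,
      (permLists Avoids231 p.1).card * (permLists Avoids231 p.2).card := by
  classical
  simp only [← Finset.card_product]
  rw [← Finset.card_sigma]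
  symm
  refine Finset.card_bij (fun x _ => x.2.1 ++ (x.1.2 :: x.2.2).map (x.1.1 + ·)) ?_ ?_ ?_
  · rintro ⟨⟨i, j⟩, ⟨A, D⟩⟩ hx
    simp only [Finset.mem_sigma, Finset.HasAntidiagonal.mem_antidiagonal, Finset.mem_product,
      mem_permLists] at hx ⊢
    obtain ⟨rfl, ⟨hA, hA'⟩, hD, hD'⟩ := hx
    have hjD : (j :: D).Perm (List.range (j + 1)) := by
      rw [List.range_succ]
      exact (hD.cons j).trans (List.perm_append_singleton _ _).symm
    exact ⟨hA.append_map_add hjD, (isSumClosed_avoids231 hA hjD).2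
      ⟨hA', (avoids231_cons_top hD).2 hD'⟩⟩
  · rintro ⟨⟨i, j⟩, ⟨A, D⟩⟩ hx ⟨⟨i', j'⟩, ⟨A', D'⟩⟩ hx' h
    simp only [Finset.mem_sigma, Finset.HasAntidiagonal.mem_antidiagonal, Finset.mem_product,
      mem_permLists] at hx hx' h
    obtain ⟨e, ⟨hA, -⟩, hD, -⟩ := hx
    obtain ⟨e', ⟨hA', -⟩, hD', -⟩ := hx'
    have hnA : n ∉ A := fun h => by
      have := ((List.perm_range_iff.1 hA).2 n).1 h; omega
    have hnA' : n ∉ A' := fun h => by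
      have := ((List.perm_range_iff.1 hA').2 n).1 h; omega
    simp only [List.map_cons] at h
    rw [e, e'] at h
    have hlen : A = A' := by
      -- The left summand is recovered as the part before the maximum `n`.
      have := congrArg (List.takeWhile (fun x => decide (x ≠ n))) h
      rw [List.takeWhile_append_of_pos, List.takeWhile_append_of_pos] at this
      · simpa using this
      · intro a ha; exact decide_eq_true fun e : a = n => hnA' (e ▸ ha)
      · intro a ha; exact decide_eq_true fun e : a = n => hnA (e ▸ ha)
    subst hlen
    obtain rfl : i = i' := (List.perm_range_length hA).symm.trans (List.perm_range_length hA')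
    obtain rfl : j = j' := by omega
    have := List.append_cancel_left h
    rw [List.cons.injEq] at this
    rw [List.map_injective_iff.2 (add_right_injective i) this.2]
  · intro l hl
    obtain ⟨hl, hav⟩ := mem_permLists.1 hl
    have hm := List.perm_range_iff.1 hl
    obtain ⟨A, D, rfl⟩ := List.append_of_mem ((hm.2 n).2 (by omega))
    have hnd := hm.1
    rw [List.nodup_append, List.nodup_cons] at hnd
    obtain ⟨hA, ⟨hnD, hDn⟩, hAD⟩ := hnd
    have hlt : ∀ x ∈ A, ∀ y ∈ n :: D, x < y := by
      intro x hx y hy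
      have hxn : x < n := by
        have h1 := (hm.2 x).1 (by simp [hx])
        have h2 := hAD x hx n (by simp)
        omega
      rcases List.mem_cons.1 hy with rfl | hy'
      · exact hxn
      · by_contra hyx
        have hne := hAD x hx y hy
        exact hav y x n (triple_sublist_append.2 (.inr (.inr (.inl
          ⟨hx, (List.singleton_sublist.2 hy').cons_cons n⟩)))) (by omega) hxn
    obtain ⟨hA', Y, hY, hYeq⟩ := List.perm_range_of_append hl hlt
    rcases Y with _ | ⟨j, D'⟩
    · simp at hYeq
    rw [List.map_cons, List.cons.injEq] at hYeq
    obtain ⟨hj, rfl⟩ := hYeq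
    have hlen := List.perm_range_length hl
    simp only [List.length_append, List.length_cons, List.length_map] at hlen hY
    obtain rfl : j = D'.length := by omega
    have hD' : D'.Perm (List.range D'.length) := by
      rw [List.range_succ] at hY
      exact List.perm_cons _ |>.1 (hY.trans (List.perm_append_singleton _ _))
    have hav2 : Avoids231 (A ++ (D'.length :: D').map (A.length + ·)) := by
      rw [List.map_cons, ← hj]; exact hav
    rw [isSumClosed_avoids231 hA' hY, avoids231_cons_top hD'] at hav2
    refine ⟨⟨(A.length, D'.length), (A, D')⟩, ?_, ?_⟩
    · simp only [Finset.mem_sigma, Finset.HasAntidiagonal.mem_antidiagonal, Finset.mem_product,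
        mem_permLists]
      exact ⟨by omega, ⟨hA', hav2.1⟩, hD', hav2.2⟩
    · simp only [List.map_cons]
      rw [← hj]

/-! ### Marked permutations and the logarithmic derivative. -/

section Marked
open PowerSeries

theorem avoids231_nil : Avoids231 [] := by
  intro a b c h; simp at h

theorem permSeries_avoids231_eq :
    permSeries Avoids231 ℚ = 1 + X * permSeries Avoids231 ℚ ^ 2 := by
  ext n
  cases n with
  | zero => simp [permSeries, permLists_zero avoids231_nil]
  | succ n =>
    rw [map_add, coeff_succ_X_mul, pow_two, coeff_mul, permSeries, coeff_mk,
      card_permLists_avoids231_succ]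
    simp [coeff_one]

/-- The first `j` entries of `l` are smaller than the others. -/
def IsCutAt (l : List ℕ) (j : ℕ) : Prop := ∀ x ∈ l.take j, ∀ y ∈ l.drop j, x < y

open Classical in
/-- Permutations of size `n` with a marked position in their first sum-indecomposable block. -/
noncomputable def markedPerms (P : List ℕ → Prop) (n : ℕ) : Finset (List ℕ × ℕ) :=
  (permLists P n ×ˢ Finset.range n).filter fun q => ∀ j, 1 ≤ j → j ≤ q.2 → ¬ IsCutAt q.1 j

theorem mem_markedPerms {P : List ℕ → Prop} {n : ℕ} {q : List ℕ × ℕ} :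
    q ∈ markedPerms P n ↔ (q.1.Perm (List.range n) ∧ P q.1) ∧ q.2 < n ∧
      ∀ j, 1 ≤ j → j ≤ q.2 → ¬ IsCutAt q.1 j := by
  simp only [markedPerms, Finset.mem_filter, Finset.mem_product, mem_permLists, Finset.mem_range,
    and_assoc]

theorem isCutAt_append_map_add {X Y : List ℕ} {i k : ℕ} (hX : X.Perm (List.range i)) :
    IsCutAt (X ++ Y.map (i + ·)) (i + k) ↔ IsCutAt Y k := by
  have hi := List.perm_range_length hX
  unfold IsCutAt
  rw [← hi, List.take_length_add_append, List.drop_length_add_append, ← List.map_take,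
    ← List.map_drop]
  constructor
  · intro h x hx y hy
    have := h (X.length + x) (List.mem_append_right _ (List.mem_map_of_mem hx)) (X.length + y)
      (List.mem_map_of_mem hy)
    omega
  · intro h x hx y hy
    obtain ⟨y', hy', rfl⟩ := List.mem_map.1 hy
    rcases List.mem_append.1 hx with hx | hx
    · have := ((List.perm_range_iff.1 hX).2 x).1 hx
      omega
    · obtain ⟨x', hx', rfl⟩ := List.mem_map.1 hx
      have := h x' hx' y' hy'
      omega

theorem isCutAt_append_map_add_self {X Y : List ℕ} {i : ℕ} (hX : X.Perm (List.range i)) :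
    IsCutAt (X ++ Y.map (i + ·)) i :=
  (isCutAt_append_map_add (k := 0) hX).2 (by simp [IsCutAt])

/-- If `i < i'`, the cut at `i'` would be a cut of `Y` at a position in `[1, t]`. -/
theorem le_of_append_map_add_eq {X Y X' Y' : List ℕ} {i t i' t' : ℕ}
    (hX : X.Perm (List.range i)) (hX' : X'.Perm (List.range i'))
    (ht : ∀ j, 1 ≤ j → j ≤ t → ¬ IsCutAt Y j) (hti : i + t = i' + t')
    (h : X ++ Y.map (i + ·) = X' ++ Y'.map (i' + ·)) : i' ≤ i := by
  by_contra hlt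
  refine ht (i' - i) (by omega) (by omega) ((isCutAt_append_map_add hX).1 ?_)
  rw [h, show i + (i' - i) = i' by omega]
  exact isCutAt_append_map_add_self hX'

/-- The right side counts permutations with an arbitrary marked position. Splitting at the last cut
not beyond the mark leaves the mark in the first block of the second summand. -/
theorem sum_card_mul_card_markedPerms {P : List ℕ → Prop} (hP : IsSumClosed P) (n : ℕ) :
    ∑ p ∈ Finset.HasAntidiagonal.antidiagonal n,
      (permLists P p.1).card * (markedPerms P p.2).card = (permLists P n).card * n := by
  classical
  conv_rhs => rw [← Finset.card_range n, ← Finset.card_product, Finset.card_range]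
  simp only [← Finset.card_product]
  rw [← Finset.card_sigma]
  refine Finset.card_bij
    (fun x _ => (x.2.1 ++ x.2.2.1.map (x.1.1 + ·), x.1.1 + x.2.2.2)) ?_ ?_ ?_
  · rintro ⟨⟨i, j⟩, ⟨X, ⟨Y, t⟩⟩⟩ hx
    simp only [Finset.mem_sigma, Finset.HasAntidiagonal.mem_antidiagonal, Finset.mem_product,
      mem_permLists, mem_markedPerms, Finset.mem_range] at hx ⊢
    obtain ⟨rfl, ⟨hX, hX'⟩, ⟨hY, hY'⟩, ht, -⟩ := hx
    exact ⟨⟨hX.append_map_add hY, (hP hX hY).2 ⟨hX', hY'⟩⟩, by omega⟩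
  · rintro ⟨⟨i, j⟩, ⟨X, ⟨Y, t⟩⟩⟩ hx ⟨⟨i', j'⟩, ⟨X', ⟨Y', t'⟩⟩⟩ hx' h
    simp only [Finset.mem_sigma, Finset.HasAntidiagonal.mem_antidiagonal, Finset.mem_product,
      mem_permLists, mem_markedPerms, Prod.mk.injEq] at hx hx' h
    obtain ⟨e, ⟨hX, -⟩, -, -, ht⟩ := hx
    obtain ⟨e', ⟨hX', -⟩, -, -, ht'⟩ := hx'
    have h1 := le_of_append_map_add_eq hX hX' ht h.2 h.1
    have h2 := le_of_append_map_add_eq hX' hX ht' h.2.symm h.1.symm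
    obtain rfl : i = i' := le_antisymm h2 h1
    obtain rfl : j = j' := by omega
    obtain rfl : t = t' := by omega
    obtain ⟨rfl, h4⟩ := List.append_inj h.1
      ((List.perm_range_length hX).trans (List.perm_range_length hX').symm)
    rw [List.map_injective_iff.2 (add_right_injective i) h4]
  · rintro ⟨l, s⟩ hl
    simp only [Finset.mem_product, mem_permLists, Finset.mem_range] at hl
    obtain ⟨⟨hl, hPl⟩, hs⟩ := hl
    have hn := List.perm_range_length hl
    have hi := Nat.findGreatest_spec (P := IsCutAt l) (n := s) (Nat.zero_le s) (by simp [IsCutAt])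
    have hile := Nat.findGreatest_le (P := IsCutAt l) s
    have hig : ∀ k, Nat.findGreatest (IsCutAt l) s < k → k ≤ s → ¬ IsCutAt l k :=
      fun k => Nat.findGreatest_is_greatest
    generalize Nat.findGreatest (IsCutAt l) s = i at hi hile hig
    have hl2 := hl
    rw [← List.take_append_drop i l] at hl2
    obtain ⟨hX, Y, hY, hYeq⟩ := List.perm_range_of_append hl2 hi
    have hlen : (l.take i).length = i := by rw [List.length_take]; omega
    have hlen' : (l.drop i).length = n - i := by rw [List.length_drop]; omega
    rw [hlen] at hX hYeq
    rw [hlen'] at hY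
    have hleq : l = l.take i ++ Y.map (i + ·) := by
      conv_lhs => rw [← List.take_append_drop i l, hYeq]
    have hPP := hPl
    rw [hleq, hP hX hY] at hPP
    refine ⟨⟨(i, n - i), (l.take i, (Y, s - i))⟩, ?_, ?_⟩
    · simp only [Finset.mem_sigma, Finset.HasAntidiagonal.mem_antidiagonal, Finset.mem_product,
        mem_permLists, mem_markedPerms]
      refine ⟨by omega, ⟨hX, hPP.1⟩, ⟨hY, hPP.2⟩, by omega, fun j h1 h2 hc => ?_⟩
      refine hig (i + j) (by omega) (by omega) ?_
      rw [hleq]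
      exact (isCutAt_append_map_add hX).2 hc
    · simp only [Prod.mk.injEq]
      exact ⟨hleq.symm, by omega⟩

/-- The generating function of marked permutations is `X C' / C`. -/
theorem markedSeries_mul {P : List ℕ → Prop} (hP : IsSumClosed P) :
    (mk fun n => ((markedPerms P n).card : ℚ)) * permSeries P ℚ =
      X * d⁄dX ℚ (permSeries P ℚ) := by
  ext n
  have h := congrArg (Nat.cast (R := ℚ)) (sum_card_mul_card_markedPerms hP n)
  rw [mul_comm, coeff_mul]
  simp only [permSeries, coeff_mk]
  push_cast at h
  rw [h]
  cases n with
  | zero => simp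
  | succ n => rw [coeff_succ_X_mul, coeff_derivative, coeff_mk]; push_cast; ring

theorem card_markedPerms_avoids2413 {n : ℕ} (hn : 1 ≤ n) :
    ((markedPerms Avoids2413 n).card : ℚ) = ∑ k ∈ Finset.range n,
      (((n : ℚ) - (k : ℚ)) / (n : ℚ)) * (Nat.choose (n - 1 + k) k : ℚ) * 2 ^ k := by
  rw [← coeff_of_mul_permSeries_avoids2413 (markedSeries_mul isSumClosed_avoids2413) hn, coeff_mk]

theorem card_markedPerms_avoids231 {n : ℕ} (hn : 1 ≤ n) :
    (markedPerms Avoids231 n).card = (2 * n - 1).choose n := by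
  have := coeff_of_mul_catalanSeries permSeries_avoids231_eq
    (markedSeries_mul isSumClosed_avoids231) hn
  rw [coeff_mk] at this
  exact_mod_cast this
end Marked

/-! ### Periodic extensions and their patterns. -/

theorem List.map_getD_range (l : List ℕ) : (List.range l.length).map (fun i => l.getD i 0) = l := by
  refine List.ext_getElem (by simp) fun i h1 h2 => ?_
  simp [h2]

theorem sublist_range_of_pairwise {l : List ℕ} {n : ℕ} (h : l.Pairwise (· < ·))
    (hn : ∀ x ∈ l, x < n) : List.Sublist l (List.range n) := by
  refine List.sublist_of_subperm_of_pairwise (r := (· < ·)) ?_ h List.pairwise_lt_range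
  exact List.subperm_of_subset (h.imp ne_of_lt) fun x hx => List.mem_range.2 (hn x hx)

theorem triple_sublist_iff_getD {l : List ℕ} {a b c : ℕ} :
    List.Sublist [a, b, c] l ↔ ∃ i j k, i < j ∧ j < k ∧ k < l.length ∧
      l.getD i 0 = a ∧ l.getD j 0 = b ∧ l.getD k 0 = c := by
  conv_lhs => rw [← List.map_getD_range l, triple_sublist_map]
  constructor
  · rintro ⟨i, j, k, h, h'⟩
    have h1 := List.pairwise_lt_range.sublist h
    have h2 : k ∈ List.range l.length := h.subset (by simp)
    simp at h1 h2
    exact ⟨i, j, k, h1.1.1, h1.2, h2, h'⟩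
  · rintro ⟨i, j, k, h1, h2, h3, h'⟩
    refine ⟨i, j, k, sublist_range_of_pairwise ?_ ?_, h'⟩
    · simp; omega
    · simp; omega

theorem quadruple_sublist_iff_getD {l : List ℕ} {a b c d : ℕ} :
    List.Sublist [a, b, c, d] l ↔ ∃ i j k m, i < j ∧ j < k ∧ k < m ∧ m < l.length ∧
      l.getD i 0 = a ∧ l.getD j 0 = b ∧ l.getD k 0 = c ∧ l.getD m 0 = d := by
  conv_lhs => rw [← List.map_getD_range l, quadruple_sublist_map]
  constructor
  · rintro ⟨i, j, k, m, h, h'⟩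
    have h1 := List.pairwise_lt_range.sublist h
    have h2 : m ∈ List.range l.length := h.subset (by simp)
    simp at h1 h2
    exact ⟨i, j, k, m, h1.1.1, h1.2.1.1, h1.2.2, h2, h'⟩
  · rintro ⟨i, j, k, m, h1, h2, h3, h4, h'⟩
    refine ⟨i, j, k, m, sublist_range_of_pairwise ?_ ?_, h'⟩
    · simp; omega
    · simp; omega

/-- The periodic extension of a permutation of `0, …, n - 1` to the integers. -/
def periodicExt (l : List ℕ) (x : ℤ) : ℤ :=
  l.length * (x / l.length) + l.getD (x % l.length).toNat 0

theorem getD_lt {l : List ℕ} {n r : ℕ} (hl : l.Perm (List.range n)) (hr : r < n) :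
    l.getD r 0 < n := by
  have hn := List.perm_range_length hl
  rw [List.getD_eq_getElem _ _ (by omega)]
  exact ((List.perm_range_iff.1 hl).2 _).1 (List.getElem_mem _)

theorem periodicExt_mul_add {l : List ℕ} (q : ℤ) {r : ℕ} (hr : r < l.length) :
    periodicExt l (l.length * q + r) = l.length * q + l.getD r 0 := by
  unfold periodicExt
  have h1 : ((l.length : ℤ) * q + r) / l.length = q := by
    rw [Int.mul_add_ediv_left _ _ (by omega), Int.ediv_eq_zero_of_lt (by omega) (by omega)]
    ring
  have h2 : ((l.length : ℤ) * q + r) % l.length = r := by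
    rw [Int.mul_add_emod_self_left, Int.emod_eq_of_lt (by omega) (by omega)]
  rw [h1, h2]
  simp

theorem exists_eq_mul_add {n : ℕ} (hn : 0 < n) (x : ℤ) :
    ∃ q : ℤ, ∃ r : ℕ, r < n ∧ x = n * q + r := by
  refine ⟨x / n, (x % n).toNat, ?_, ?_⟩
  · have := Int.emod_lt_of_pos x (show (0 : ℤ) < n by omega)
    have := Int.emod_nonneg x (show (n : ℤ) ≠ 0 by omega)
    omega
  · have := Int.emod_nonneg x (show (n : ℤ) ≠ 0 by omega)
    rw [Int.toNat_of_nonneg this, Int.mul_ediv_add_emod]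

theorem periodicExt_natCast {l : List ℕ} {r : ℕ} (hr : r < l.length) :
    periodicExt l r = l.getD r 0 := by
  simpa using periodicExt_mul_add 0 hr

theorem mul_le_mul_add_iff {n : ℕ} {q q' : ℤ} {r : ℕ} (hr : r < n) :
    (n : ℤ) * q ≤ n * q' + r ↔ q ≤ q' := by
  constructor
  · intro h
    by_contra hlt
    have : (n : ℤ) * (q' + 1) ≤ n * q := mul_le_mul_of_nonneg_left (by omega) (by omega)
    rw [mul_add] at this
    omega
  · intro h
    have : (n : ℤ) * q ≤ n * q' := mul_le_mul_of_nonneg_left h (by omega)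
    omega

/-- Each window from `n * q` to `n * q + n - 1` is mapped to itself. -/
theorem le_periodicExt_iff {l : List ℕ} {n : ℕ} (hl : l.Perm (List.range n)) (hn : 0 < n)
    {q x : ℤ} : n * q ≤ periodicExt l x ↔ n * q ≤ x := by
  have hlen := List.perm_range_length hl
  obtain ⟨q', r, hr, rfl⟩ := exists_eq_mul_add hn x
  have := periodicExt_mul_add (l := l) q' (hlen.symm ▸ hr)
  rw [hlen] at this
  rw [this, mul_le_mul_add_iff hr, mul_le_mul_add_iff (getD_lt hl hr)]

theorem periodicExt_add_length {l : List ℕ} {n : ℕ} (hl : l.Perm (List.range n)) (hn : 0 < n)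
    (x : ℤ) : periodicExt l (x + n) = periodicExt l x + n := by
  have hlen := List.perm_range_length hl
  obtain ⟨q, r, hr, rfl⟩ := exists_eq_mul_add hn x
  rw [← hlen] at hr ⊢
  rw [show (l.length : ℤ) * q + r + l.length = l.length * (q + 1) + r by ring,
    periodicExt_mul_add _ hr, periodicExt_mul_add _ hr]
  ring

theorem periodicExt_bijective {l : List ℕ} {n : ℕ} (hl : l.Perm (List.range n)) (hn : 0 < n) :
    Function.Bijective (periodicExt l) := by
  have hlen := List.perm_range_length hl
  have hm := List.perm_range_iff.1 hl
  constructor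
  · intro x y hxy
    obtain ⟨q, r, hr, rfl⟩ := exists_eq_mul_add hn x
    obtain ⟨q', r', hr', rfl⟩ := exists_eq_mul_add hn y
    have h1 := getD_lt hl hr
    have h2 := getD_lt hl hr'
    rw [← hlen] at hr hr' hxy ⊢
    rw [periodicExt_mul_add _ hr, periodicExt_mul_add _ hr', hlen] at hxy
    obtain rfl : q = q' := le_antisymm
      ((mul_le_mul_add_iff h2).1 (by omega)) ((mul_le_mul_add_iff h1).1 (by omega))
    have h3 : l.getD r 0 = l.getD r' 0 := by omega
    rw [List.getD_eq_getElem _ _ hr, List.getD_eq_getElem _ _ hr', hm.1.getElem_inj_iff] at h3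
    rw [h3]
  · intro y
    obtain ⟨q, s, hs, rfl⟩ := exists_eq_mul_add hn y
    obtain ⟨r, hr, hrs⟩ := List.getElem_of_mem ((hm.2 s).2 hs)
    refine ⟨l.length * q + r, ?_⟩
    rw [periodicExt_mul_add q hr, List.getD_eq_getElem _ _ hr, hrs, hlen]

theorem forall_lt_periodicExt_iff_isCutAt {l : List ℕ} {n k : ℕ} (hl : l.Perm (List.range n))
    (hn : 0 < n) (hk : k ≤ n) :
    (∀ i j : ℤ, i < k → k ≤ j → periodicExt l i < periodicExt l j) ↔ IsCutAt l k := by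
  have hlen := List.perm_range_length hl
  have hlo : ∀ x, 0 ≤ periodicExt l x ↔ 0 ≤ x := fun x => by
    have := le_periodicExt_iff hl hn (q := 0) (x := x); simpa using this
  have hhi : ∀ x, n ≤ periodicExt l x ↔ n ≤ x := fun x => by
    have := le_periodicExt_iff hl hn (q := 1) (x := x); simpa using this
  constructor
  · intro h x hx y hy
    obtain ⟨a, ha, rfl⟩ := List.getElem_of_mem hx
    obtain ⟨b, hb, rfl⟩ := List.getElem_of_mem hy
    rw [List.length_take] at ha
    rw [List.length_drop] at hb
    have := h a ((k + b : ℕ) : ℤ) (by omega) (by omega)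
    rw [periodicExt_natCast (by omega), periodicExt_natCast (by omega),
      List.getD_eq_getElem _ _ (by omega), List.getD_eq_getElem _ _ (by omega)] at this
    rw [List.getElem_take, List.getElem_drop]
    exact_mod_cast this
  · intro h i j hi hj
    by_cases h1 : 0 ≤ i
    · by_cases h2 : (n : ℤ) ≤ j
      · have h3 := (hhi j).2 h2
        have h4 := (hhi i).not.2 (by omega)
        omega
      · lift i to ℕ using h1
        lift j to ℕ using by omega
        rw [periodicExt_natCast (by omega), periodicExt_natCast (by omega),
          List.getD_eq_getElem _ _ (by omega), List.getD_eq_getElem _ _ (by omega)]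
        have := h l[i] (List.mem_take_iff_getElem.2 ⟨i, by omega, rfl⟩) l[j]
          (List.mem_drop_iff_getElem.2 ⟨j - k, by omega, by congr 1; omega⟩)
        exact_mod_cast this
    · have h3 := (hlo i).not.2 h1
      have h4 := (hlo j).2 (by omega)
      omega

/-- Since 231 is sum-indecomposable, no window boundary separates its entries: an occurrence lies in
the window of its last position. -/
theorem periodicExt_231_iff {l : List ℕ} {n : ℕ} (hl : l.Perm (List.range n)) (hn : 0 < n) :
    (∃ i j k : ℤ, i < j ∧ j < k ∧ periodicExt l k < periodicExt l i ∧
      periodicExt l i < periodicExt l j) ↔ ¬ Avoids231 l := by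
  have hlen := List.perm_range_length hl
  constructor
  · rintro ⟨i, j, k, hij, hjk, h1, h2⟩ hav
    have hcut : ∀ q : ℤ, n * q ≤ k → n * q ≤ i := by
      intro q hq
      rw [← le_periodicExt_iff hl hn] at hq ⊢
      omega
    obtain ⟨q, r, hr, rfl⟩ := exists_eq_mul_add hn k
    have hi := hcut q (by omega)
    obtain ⟨a, rfl⟩ := Int.le.dest hi
    obtain ⟨b, rfl⟩ := Int.le.dest (hi.trans hij.le)
    rw [← hlen] at hr h1 h2
    rw [periodicExt_mul_add q hr, periodicExt_mul_add q (by omega)] at h1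
    rw [periodicExt_mul_add q (show a < l.length by omega),
      periodicExt_mul_add q (show b < l.length by omega)] at h2
    exact hav _ _ _ (triple_sublist_iff_getD.2 ⟨a, b, r, by omega, by omega, hr, rfl, rfl, rfl⟩)
      (by omega) (by omega)
  · intro h
    unfold Avoids231 at h
    push Not at h
    obtain ⟨a, b, c, hs, h1, h2, -⟩ := h
    obtain ⟨i, j, k, hij, hjk, hk, rfl, rfl, rfl⟩ := triple_sublist_iff_getD.1 hs
    refine ⟨i, j, k, by omega, by omega, ?_⟩
    rw [periodicExt_natCast hk, periodicExt_natCast (by omega), periodicExt_natCast (by omega)]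
    omega

theorem periodicExt_2413_iff {l : List ℕ} {n : ℕ} (hl : l.Perm (List.range n)) (hn : 0 < n) :
    (∃ i j k m : ℤ, i < j ∧ j < k ∧ k < m ∧ periodicExt l k < periodicExt l i ∧
      periodicExt l i < periodicExt l m ∧ periodicExt l m < periodicExt l j) ↔
      ¬ Avoids2413 l := by
  have hlen := List.perm_range_length hl
  constructor
  · rintro ⟨i, j, k, m, hij, hjk, hkm, h1, h2, h3⟩ hav
    -- The bound passes from `m` to the larger value at `j`, then to the later position `k`, then to
    -- the larger value at `i`.
    have hcut : ∀ q : ℤ, n * q ≤ m → n * q ≤ i := by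
      intro q hq
      have e1 := le_periodicExt_iff hl hn (q := q) (x := i)
      have e2 := le_periodicExt_iff hl hn (q := q) (x := j)
      have e3 := le_periodicExt_iff hl hn (q := q) (x := k)
      have e4 := le_periodicExt_iff hl hn (q := q) (x := m)
      omega
    obtain ⟨q, r, hr, rfl⟩ := exists_eq_mul_add hn m
    have hi := hcut q (by omega)
    obtain ⟨a, rfl⟩ := Int.le.dest hi
    obtain ⟨b, rfl⟩ := Int.le.dest (hi.trans hij.le)
    obtain ⟨c, rfl⟩ := Int.le.dest ((hi.trans hij.le).trans hjk.le)
    rw [← hlen] at hr h1 h2 h3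
    rw [periodicExt_mul_add q (show a < l.length by omega)] at h1 h2
    rw [periodicExt_mul_add q (show c < l.length by omega)] at h1
    rw [periodicExt_mul_add q hr] at h2 h3
    rw [periodicExt_mul_add q (show b < l.length by omega)] at h3
    exact hav _ _ _ _ (quadruple_sublist_iff_getD.2
      ⟨a, b, c, r, by omega, by omega, by omega, hr, rfl, rfl, rfl, rfl⟩)
      (by omega) (by omega) (by omega)
  · intro h
    unfold Avoids2413 at h
    push Not at h
    obtain ⟨a, b, c, d, hs, h1, h2, h3, -⟩ := h
    obtain ⟨i, j, k, m, hij, hjk, hkm, hm, rfl, rfl, rfl, rfl⟩ :=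
      quadruple_sublist_iff_getD.1 hs
    refine ⟨i, j, k, m, by omega, by omega, by omega, ?_⟩
    rw [periodicExt_natCast hm, periodicExt_natCast (by omega), periodicExt_natCast (by omega),
      periodicExt_natCast (by omega)]
    omega

/-! ### Cuts of affine avoiders. -/

theorem containsPattern_perm231_iff {σ : Equiv.Perm ℤ} :
    ContainsPattern σ perm231 ↔ ∃ i j k : ℤ, i < j ∧ j < k ∧ σ k < σ i ∧ σ i < σ j := by
  constructor
  · rintro ⟨φ, hφ, h⟩
    exact ⟨φ 0, φ 1, φ 2, hφ (by decide), hφ (by decide), (h 2 0).2 (by decide),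
      (h 0 1).2 (by decide)⟩
  · rintro ⟨i, j, k, hij, hjk, h1, h2⟩
    refine ⟨![i, j, k], ?_, ?_⟩
    · rw [Fin.strictMono_iff_lt_succ]
      intro a; fin_cases a <;> simpa
    · intro a b
      fin_cases a <;> fin_cases b <;> simp [perm231] <;> omega

theorem containsPattern_perm2413_iff {σ : Equiv.Perm ℤ} :
    ContainsPattern σ perm2413 ↔ ∃ i j k m : ℤ, i < j ∧ j < k ∧ k < m ∧ σ k < σ i ∧ σ i < σ m ∧
      σ m < σ j := by
  constructor
  · rintro ⟨φ, hφ, h⟩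
    exact ⟨φ 0, φ 1, φ 2, φ 3, hφ (by decide), hφ (by decide), hφ (by decide),
      (h 2 0).2 (by decide), (h 0 3).2 (by decide), (h 3 1).2 (by decide)⟩
  · rintro ⟨i, j, k, m, hij, hjk, hkm, h1, h2, h3⟩
    refine ⟨![i, j, k, m], ?_, ?_⟩
    · rw [Fin.strictMono_iff_lt_succ]
      intro a; fin_cases a <;> simpa
    · intro a b
      fin_cases a <;> fin_cases b <;> simp [perm2413] <;> omega

/-- All values of `f` before `k` are smaller than those from `k` on. -/
def IsCutOf (f : ℤ → ℤ) (k : ℤ) : Prop := ∀ i j, i < k → k ≤ j → f i < f j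

theorem sum_range_add_eq_of_periodic {f : ℤ → ℤ} {n : ℕ} (hf : ∀ x, f (x + n) = f x) (k : ℤ) :
    ∑ r ∈ Finset.range n, f (k + r) = ∑ r ∈ Finset.range n, f r := by
  have step : ∀ k, ∑ r ∈ Finset.range n, f (k + 1 + r) = ∑ r ∈ Finset.range n, f (k + r) := by
    intro k
    have h1 := Finset.sum_range_succ (fun r : ℕ => f (k + r)) n
    have h2 := Finset.sum_range_succ' (fun r : ℕ => f (k + r)) n
    rw [h1, hf k] at h2
    simp only [Nat.cast_zero, add_zero, Nat.cast_add, Nat.cast_one] at h2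
    rw [add_right_cancel h2]
    exact Finset.sum_congr rfl fun r _ => by rw [add_assoc, add_comm 1]
  induction k using Int.induction_on with
  | zero => simp
  | succ i ih => rw [step, ih]
  | pred i ih => rw [← ih, ← step (-i - 1), sub_add_cancel]

theorem sum_Icc_one_eq_sum_range (f : ℤ → ℤ) (n : ℕ) :
    ∑ i ∈ Finset.Icc (1 : ℤ) n, f i = ∑ r ∈ Finset.range n, f (1 + r) := by
  symm
  refine Finset.sum_nbij' (fun r : ℕ => 1 + (r : ℤ)) (fun i => (i - 1).toNat) ?_ ?_ ?_ ?_ ?_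
  · intro r hr; simp at hr ⊢; omega
  · intro i hi; simp at hi ⊢; omega
  · intro r hr; simp
  · intro i hi; simp at hi ⊢; omega
  · intro r hr; rfl

/-- The displacement `σ x - x` is periodic, so its sum may be taken over any window of length `n`.
-/
theorem isAffinePerm_iff {n : ℕ} {σ : Equiv.Perm ℤ} (k : ℤ) :
    IsAffinePerm n σ ↔ (∀ x, σ (x + n) = σ x + n) ∧
      ∑ r ∈ Finset.range n, (σ (k + r) - (k + r)) = 0 := by
  refine and_congr_right fun h => ?_
  have hf : ∀ x, (fun x => σ x - x) (x + n) = (fun x => σ x - x) x := fun x => by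
    simp only [h x]; ring
  have h1 := sum_range_add_eq_of_periodic (f := fun x => σ x - x) hf 1
  have h2 := sum_range_add_eq_of_periodic (f := fun x => σ x - x) hf k
  rw [← sub_eq_zero, ← Finset.sum_sub_distrib, sum_Icc_one_eq_sum_range (fun i => σ i - i)]
  rw [h1, h2]

theorem apply_mul_add_of_periodic {n : ℕ} {σ : Equiv.Perm ℤ} (h : ∀ x, σ (x + n) = σ x + n)
    (q x : ℤ) : σ (n * q + x) = n * q + σ x := by
  induction q using Int.induction_on with
  | zero => simp
  | succ i ih =>
    have := h (n * i + x)
    rw [show (n : ℤ) * (i + 1) + x = n * i + x + n by ring, this, ih]; ring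
  | pred i ih =>
    have := h (n * (-i - 1) + x)
    rw [show (n : ℤ) * (-i - 1) + x + n = n * -i + x by ring, ih] at this
    linear_combination -this

theorem exists_abs_sub_le {n : ℕ} (hn : 0 < n) {σ : Equiv.Perm ℤ}
    (h : ∀ x, σ (x + n) = σ x + n) : ∃ M, ∀ x, |σ x - x| ≤ M := by
  refine ⟨∑ r ∈ Finset.range n, |σ r - r|, fun x => ?_⟩
  obtain ⟨q, r, hr, rfl⟩ := exists_eq_mul_add hn x
  rw [apply_mul_add_of_periodic h, add_sub_add_left_eq_sub]
  exact Finset.single_le_sum (f := fun r : ℕ => |σ r - r|) (fun r _ => abs_nonneg _)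
    (Finset.mem_range.2 hr)

/-- Displacements are bounded, so the values at positions `≤ 0` attain a maximum. -/
theorem exists_record {n : ℕ} (hn : 0 < n) {σ : Equiv.Perm ℤ}
    (h : ∀ x, σ (x + n) = σ x + n) : ∃ p, ∀ i < p, σ i < σ p := by
  obtain ⟨M, hM⟩ := exists_abs_sub_le hn h
  obtain ⟨v, ⟨p, hp, rfl⟩, hv⟩ := Int.exists_greatest_of_bdd (P := fun v => ∃ p ≤ 0, σ p = v)
    ⟨M, by rintro _ ⟨p, hp, rfl⟩; have := (abs_le.1 (hM p)).2; omega⟩ ⟨σ 0, 0, le_rfl, rfl⟩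
  refine ⟨p, fun i hi => lt_of_le_of_ne (hv _ ⟨i, by omega, rfl⟩) fun he => ?_⟩
  have := σ.injective he
  omega

/-- A record `p` is itself a cut: a later value below an earlier one would form a 231 with `p` in
the middle. -/
theorem exists_isCutOf_of_avoids231 {n : ℕ} (hn : 0 < n) {σ : Equiv.Perm ℤ}
    (h : ∀ x, σ (x + n) = σ x + n) (hav : ¬ ContainsPattern σ perm231) : ∃ k, IsCutOf σ k := by
  obtain ⟨p, hp⟩ := exists_record hn h
  refine ⟨p, fun i j hi hj => ?_⟩
  rcases hj.eq_or_lt with rfl | hj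
  · exact hp i hi
  · by_contra hlt
    have hne : σ j ≠ σ i := fun he => by have := σ.injective he; omega
    exact hav (containsPattern_perm231_iff.2 ⟨i, p, j, hi, hj, by omega, hp i hi⟩)

/-- Let `p` be a record and `q` the last position with value at most `σ p`. If `i ≤ q < j` and `σ j
< σ i`, then `p`, `i`, `q`, `j` carry a 2413; so `q + 1` is a cut. -/
theorem exists_isCutOf_of_avoids2413 {n : ℕ} (hn : 0 < n) {σ : Equiv.Perm ℤ}
    (h : ∀ x, σ (x + n) = σ x + n) (hav : ¬ ContainsPattern σ perm2413) : ∃ k, IsCutOf σ k := by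
  obtain ⟨p, hp⟩ := exists_record hn h
  obtain ⟨M, hM⟩ := exists_abs_sub_le hn h
  obtain ⟨q, hq, hqmax⟩ := Int.exists_greatest_of_bdd (P := fun q => σ q ≤ σ p)
    ⟨σ p + M, fun z hz => by have := (abs_le.1 (hM z)).1; omega⟩ ⟨p, le_rfl⟩
  refine ⟨q + 1, fun i j hi hj => ?_⟩
  by_contra hlt
  have hne : σ j ≠ σ i := fun he => by have := σ.injective he; omega
  have hj' : σ p < σ j := by
    by_contra hle
    have := hqmax j (by omega)
    omega
  have hpi : p < i := by
    rcases lt_trichotomy i p with h1 | rfl | h1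
    · have := hp i h1; omega
    · omega
    · exact h1
  have hiq : i ≠ q := by rintro rfl; omega
  have hqp : σ q ≠ σ p := fun he => by have := σ.injective he; omega
  exact hav (containsPattern_perm2413_iff.2 ⟨p, i, q, j, hpi, by omega, by omega, by omega,
    by omega, by omega⟩)

/-! ### The correspondence between affine avoiders and marked avoiders. -/

/-- The periodic extension of `q.1`, conjugated by the translation by `q.2`. -/
def shiftedExt (q : List ℕ × ℕ) (x : ℤ) : ℤ := periodicExt q.1 (x + q.2) - q.2

theorem isCutOf_shiftedExt_iff {l : List ℕ} {n k t : ℕ} (hl : l.Perm (List.range n))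
    (hn : 0 < n) (hk : k ≤ n) : IsCutOf (shiftedExt (l, t)) (k - t) ↔ IsCutAt l k := by
  rw [← forall_lt_periodicExt_iff_isCutAt hl hn hk]
  unfold IsCutOf shiftedExt
  constructor
  · intro h i j hi hj
    have := h (i - t) (j - t) (by omega) (by omega)
    simp only [sub_add_cancel] at this
    omega
  · intro h i j hi hj
    have := h (i + t) (j + t) (by omega) (by omega)
    simp only; omega

theorem isCutOf_shiftedExt_neg {l : List ℕ} {n t : ℕ} (hl : l.Perm (List.range n))
    (hn : 0 < n) : IsCutOf (shiftedExt (l, t)) (-t) := by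
  have := (isCutOf_shiftedExt_iff (t := t) hl hn (Nat.zero_le n)).2 (by simp [IsCutAt])
  simpa using this

/-- The function has a cut at `-q.2`; if `q.2 < q'.2`, this is a cut of `q'.1` at `q'.2 - q.2`,
which the marking forbids. -/
theorem shiftedExt_le_of_eq {P : List ℕ → Prop} {n : ℕ} {q q' : List ℕ × ℕ}
    (hq : q ∈ markedPerms P n) (hq' : q' ∈ markedPerms P n) (h : shiftedExt q = shiftedExt q') :
    q'.2 ≤ q.2 := by
  obtain ⟨l, t⟩ := q
  obtain ⟨l', t'⟩ := q'
  obtain ⟨⟨hl, -⟩, ht, -⟩ := mem_markedPerms.1 hq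
  obtain ⟨⟨hl', -⟩, ht', hcut⟩ := mem_markedPerms.1 hq'
  simp only at *
  by_contra hlt
  refine hcut (t' - t) (by omega) (by omega)
    ((isCutOf_shiftedExt_iff (t := t') hl' (by omega) (by omega)).1 ?_)
  rw [← h, show ((t' - t : ℕ) : ℤ) - t' = -t by omega]
  exact isCutOf_shiftedExt_neg hl (by omega)

theorem shiftedExt_injOn (P : List ℕ → Prop) (n : ℕ) :
    Set.InjOn shiftedExt (markedPerms P n : Set (List ℕ × ℕ)) := by
  rintro ⟨l, t⟩ hq ⟨l', t'⟩ hq' h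
  obtain rfl : t = t' := le_antisymm (shiftedExt_le_of_eq hq' hq h.symm)
    (shiftedExt_le_of_eq hq hq' h)
  have hlen := List.perm_range_length (mem_markedPerms.1 hq).1.1
  have hlen' := List.perm_range_length (mem_markedPerms.1 hq').1.1
  congr 1
  simp only at hlen hlen'
  refine List.ext_getElem (hlen.trans hlen'.symm) fun i h1 h2 => ?_
  have := congrFun h (i - t)
  simp only [shiftedExt, sub_add_cancel] at this
  rw [periodicExt_natCast h1, periodicExt_natCast h2, List.getD_eq_getElem _ _ h1,
    List.getD_eq_getElem _ _ h2] at this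
  omega

theorem isAffinePerm_of_eq_shiftedExt {l : List ℕ} {n t : ℕ} (hl : l.Perm (List.range n))
    (hn : 0 < n) {σ : Equiv.Perm ℤ} (hσ : ⇑σ = shiftedExt (l, t)) : IsAffinePerm n σ := by
  have hlen := List.perm_range_length hl
  rw [isAffinePerm_iff (-t), hσ]
  constructor
  · intro x
    simp only [shiftedExt]
    rw [add_right_comm, periodicExt_add_length hl hn]; ring
  · have h1 : ∀ r ∈ Finset.range n, shiftedExt (l, t) (-t + r) - (-t + r) =
        (l.getD r 0 : ℤ) - r := by
      intro r hr
      rw [Finset.mem_range] at hr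
      simp only [shiftedExt]
      rw [show -(t : ℤ) + r + t = r by ring, periodicExt_natCast (by omega)]; ring
    rw [Finset.sum_congr rfl h1, Finset.sum_sub_distrib, sub_eq_zero]
    have h2 : ∑ r ∈ Finset.range n, l.getD r 0 = ∑ r ∈ Finset.range n, r := by
      have e2 : l.sum = (List.range n).sum := hl.sum_eq
      have e3 : ∀ f : ℕ → ℕ, ∑ r ∈ Finset.range n, f r = ((List.range n).map f).sum := fun f => rfl
      rw [e3, e3, ← hlen, List.map_getD_range, hlen, e2]
      simp
    rw [← Nat.cast_sum, ← Nat.cast_sum, h2]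

theorem exists_perm_eq_shiftedExt {l : List ℕ} {n : ℕ} (t : ℕ) (hl : l.Perm (List.range n))
    (hn : 0 < n) : ∃ σ : Equiv.Perm ℤ, ⇑σ = shiftedExt (l, t) := by
  refine ⟨(Equiv.addRight (t : ℤ)).trans ((Equiv.ofBijective _ (periodicExt_bijective hl hn)).trans
    (Equiv.subRight (t : ℤ))), ?_⟩
  ext x
  simp [shiftedExt]

/-- An affine permutation preserves the half-line above a cut. -/
theorem le_apply_iff_of_isCutOf {n : ℕ} (hn : 0 < n) {σ : Equiv.Perm ℤ} (hσ : IsAffinePerm n σ)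
    {k : ℤ} (hk : IsCutOf σ k) (x : ℤ) : k ≤ σ x ↔ k ≤ x := by
  obtain ⟨hper, hsum⟩ := (isAffinePerm_iff k).1 hσ
  obtain ⟨K, ⟨x₀, hx₀, rfl⟩, hK⟩ := Int.exists_least_of_bdd (P := fun v => ∃ x, k ≤ x ∧ σ x = v)
    ⟨σ (k - 1), by rintro _ ⟨x, hx, rfl⟩; exact (hk _ _ (by omega) hx).le⟩ ⟨σ k, k, le_rfl, rfl⟩
  have hle : ∀ x, σ x₀ ≤ σ x ↔ k ≤ x := fun x => by
    constructor
    · intro h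
      by_contra hlt
      have := hk x x₀ (by omega) hx₀
      omega
    · exact fun h => hK _ ⟨x, h, rfl⟩
  -- `K = σ x₀` is the least value on the half-line from `k`. The window of length `n` at `k` is
  -- mapped bijectively onto the window at `K`, so the displacements sum to `n * (K - k)`, which
  -- must be 0.
  have hK' : σ x₀ = k := by
    have himg : (Finset.range n).image (fun r : ℕ => (σ (k + r) - σ x₀).toNat) =
        Finset.range n := by
      refine Finset.eq_of_subset_of_card_le (fun y hy => ?_) ?_
      · obtain ⟨r, hr, rfl⟩ := Finset.mem_image.1 hy
        rw [Finset.mem_range] at hr ⊢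
        have h1 := hle (k + r - n)
        have h2 := hper (k + r - n)
        rw [sub_add_cancel] at h2
        omega
      · rw [Finset.card_image_of_injOn]
        intro r hr s hs h
        have h1 := (hle (k + r)).2 (by omega)
        have h2 := (hle (k + s)).2 (by omega)
        simp only at h
        have := σ.injective (show σ (k + r) = σ (k + s) by omega)
        omega
    have hs : ∑ r ∈ Finset.range n, (σ (k + r) - σ x₀).toNat = ∑ r ∈ Finset.range n, r := by
      conv_rhs => rw [← himg]
      rw [Finset.sum_image]
      intro r hr s hs (h : (σ (k + r) - σ x₀).toNat = (σ (k + s) - σ x₀).toNat)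
      have h1 := (hle (k + r)).2 (by omega)
      have h2 := (hle (k + s)).2 (by omega)
      have := σ.injective (show σ (k + r) = σ (k + s) by omega)
      omega
    have hs' : ∑ r ∈ Finset.range n, (σ (k + r) - σ x₀) = ∑ r ∈ Finset.range n, (r : ℤ) := by
      have := congrArg (Nat.cast (R := ℤ)) hs
      push_cast at this
      rw [← this]
      refine Finset.sum_congr rfl fun r _ => ?_
      have h1 := (hle (k + r)).2 (by omega)
      omega
    simp only [Finset.sum_sub_distrib, Finset.sum_add_distrib, Finset.sum_const,
      Finset.card_range, nsmul_eq_mul] at hs' hsum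
    have : (n : ℤ) * (σ x₀ - k) = 0 := by linear_combination hsum - hs'
    rcases mul_eq_zero.1 this with h | h <;> omega
  rw [← hle x, hK']

theorem exists_eq_shiftedExt {n : ℕ} (hn : 0 < n) {σ : Equiv.Perm ℤ} (hσ : IsAffinePerm n σ)
    {t : ℕ} (hk : IsCutOf σ (-t)) :
    ∃ l : List ℕ, l.Perm (List.range n) ∧ ⇑σ = shiftedExt (l, t) := by
  have hle := le_apply_iff_of_isCutOf hn hσ hk
  have hper := hσ.1
  have hbd : ∀ r : ℕ, r < n → 0 ≤ σ (r - t) + t ∧ σ (r - t) + t < n := by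
    intro r hr
    have h1 := hle (r - t)
    have h2 := hle (r - t - n)
    have h3 := hper (r - t - n)
    rw [sub_add_cancel] at h3
    omega
  let l := (List.range n).map fun r : ℕ => (σ (r - t) + t).toNat
  have hlen : l.length = n := by simp [l]
  have hnd : l.Nodup := by
    refine List.Nodup.map_on (fun r hr s hs h => ?_) List.nodup_range
    have h1 := hbd r (List.mem_range.1 hr)
    have h2 := hbd s (List.mem_range.1 hs)
    have := σ.injective (show σ (r - t) = σ (s - t) by omega)
    omega
  have hl : l.Perm (List.range n) := by
    refine (List.subperm_of_subset hnd fun x hx => ?_).perm_of_length_le (by simp [hlen])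
    obtain ⟨r, hr, rfl⟩ := List.mem_map.1 hx
    have := hbd r (List.mem_range.1 hr)
    rw [List.mem_range]; omega
  refine ⟨l, hl, ?_⟩
  ext x
  obtain ⟨q, r, hr, hx⟩ := exists_eq_mul_add hn (x + t)
  simp only [shiftedExt]
  rw [hx, show x = n * q + (r - t) by omega, apply_mul_add_of_periodic hper]
  have hr' : r < l.length := by omega
  have := periodicExt_mul_add q hr'
  rw [hlen] at this
  rw [this, List.getD_eq_getElem _ _ hr']
  have := hbd r hr
  simp only [l, List.getElem_map, List.getElem_range]
  omega

/-- Cuts are invariant under translation by `n`, so the greatest cut `≤ 0` exceeds `-n`. -/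
theorem exists_isCutOf_greatest {n : ℕ} (hn : 0 < n) {σ : Equiv.Perm ℤ}
    (h : ∀ x, σ (x + n) = σ x + n) (hcut : ∃ k, IsCutOf σ k) :
    ∃ t < n, IsCutOf σ (-(t : ℤ)) ∧ ∀ s < t, ¬ IsCutOf σ (-(s : ℤ)) := by
  classical
  have hadd : ∀ k, IsCutOf σ k → IsCutOf σ (k + n) := fun k hk i j hi hj => by
    have h1 := hk (i - n) (j - n) (by omega) (by omega)
    have h2 := h (i - n)
    have h3 := h (j - n)
    rw [sub_add_cancel] at h2 h3
    omega
  have hsub : ∀ k, IsCutOf σ k → IsCutOf σ (k - n) := fun k hk i j hi hj => by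
    have h1 := hk (i + n) (j + n) (by omega) (by omega)
    have h2 := h i
    have h3 := h j
    omega
  have hex : ∃ t : ℕ, IsCutOf σ (-(t : ℤ)) := by
    obtain ⟨k, hk⟩ := hcut
    have hm : ∀ m : ℕ, IsCutOf σ (k - n * m) := by
      intro m
      induction m with
      | zero => simpa using hk
      | succ m ih =>
        have := hsub _ ih
        rwa [show k - n * m - n = k - n * ((m + 1 : ℕ) : ℤ) by push_cast; ring] at this
    have h1 : k ≤ n * (k.toNat : ℤ) := by
      have : (1 : ℤ) * k.toNat ≤ n * k.toNat :=
        mul_le_mul_of_nonneg_right (by omega) (by omega)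
      omega
    refine ⟨(n * (k.toNat : ℤ) - k).toNat, ?_⟩
    rw [show -(((n * (k.toNat : ℤ) - k).toNat : ℕ) : ℤ) = k - n * (k.toNat : ℤ) by omega]
    exact hm _
  refine ⟨Nat.find hex, ?_, Nat.find_spec hex, fun s hs => Nat.find_min hex hs⟩
  by_contra hge
  refine Nat.find_min hex (m := Nat.find hex - n) (by omega) ?_
  have := hadd _ (Nat.find_spec hex)
  rwa [show -((Nat.find hex - n : ℕ) : ℤ) = -(Nat.find hex : ℤ) + n by omega]

/-- Affine avoiders correspond to marked finite avoiders if every avoider has a cut. -/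
theorem affineAvoiders_finite_and_ncard {k : ℕ} {τ : Equiv.Perm (Fin k)} {P : List ℕ → Prop}
    {n : ℕ} (hn : 0 < n)
    (hcut : ∀ σ : Equiv.Perm ℤ, (∀ x, σ (x + n) = σ x + n) → ¬ ContainsPattern σ τ →
      ∃ k, IsCutOf σ k)
    (hpat : ∀ (σ : Equiv.Perm ℤ) (l : List ℕ) (t : ℕ), l.Perm (List.range n) →
      ⇑σ = shiftedExt (l, t) → (ContainsPattern σ τ ↔ ¬ P l)) :
    (affineAvoiders n τ).Finite ∧ (affineAvoiders n τ).ncard = (markedPerms P n).card := by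
  have himg : (fun σ : Equiv.Perm ℤ => (⇑σ : ℤ → ℤ)) '' affineAvoiders n τ =
      shiftedExt '' (markedPerms P n : Set (List ℕ × ℕ)) := by
    ext f
    simp only [Set.mem_image, Finset.mem_coe]
    constructor
    · rintro ⟨σ, ⟨hσ, hav⟩, rfl⟩
      obtain ⟨t, ht, htc, hmax⟩ := exists_isCutOf_greatest hn hσ.1 (hcut σ hσ.1 hav)
      obtain ⟨l, hl, hσl⟩ := exists_eq_shiftedExt hn hσ htc
      refine ⟨(l, t), mem_markedPerms.2 ⟨⟨hl, ?_⟩, ht, fun j h1 h2 hc => ?_⟩, hσl.symm⟩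
      · by_contra hP
        exact hav ((hpat σ l t hl hσl).2 hP)
      · simp only at h2 hc
        refine hmax (t - j) (by omega) ?_
        rw [hσl, show -((t - j : ℕ) : ℤ) = j - t by omega]
        exact (isCutOf_shiftedExt_iff hl hn (by omega)).2 hc
    · rintro ⟨⟨l, t⟩, hq, rfl⟩
      obtain ⟨⟨hl, hP⟩, -⟩ := mem_markedPerms.1 hq
      obtain ⟨σ, hσ⟩ := exists_perm_eq_shiftedExt t hl hn
      exact ⟨σ, ⟨isAffinePerm_of_eq_shiftedExt hl hn hσ,
        fun hc => (hpat σ l t hl hσ).1 hc hP⟩, hσ⟩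
  have hinj : Function.Injective fun σ : Equiv.Perm ℤ => (⇑σ : ℤ → ℤ) := DFunLike.coe_injective
  constructor
  · refine Set.Finite.of_finite_image ?_ hinj.injOn
    rw [himg]
    exact (Finset.finite_toSet _).image _
  · rw [← Set.ncard_image_of_injective _ hinj, himg,
      (shiftedExt_injOn P n).ncard_image, Set.ncard_coe_finset]

theorem affineAvoiders_perm231 {n : ℕ} (hn : 1 ≤ n) : (affineAvoiders n perm231).Finite ∧
    (affineAvoiders n perm231).ncard = (2 * n - 1).choose n := by
  rw [← card_markedPerms_avoids231 hn]
  refine affineAvoiders_finite_and_ncard hn (fun σ => exists_isCutOf_of_avoids231 hn)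
    fun σ l t hl hσ => ?_
  rw [containsPattern_perm231_iff, ← periodicExt_231_iff hl hn, hσ]
  unfold shiftedExt
  constructor
  · rintro ⟨i, j, k, h⟩
    exact ⟨i + t, j + t, k + t, by simp only at h; omega⟩
  · rintro ⟨i, j, k, h⟩
    exact ⟨i - t, j - t, k - t, by simp only [sub_add_cancel]; omega⟩

theorem affineAvoiders_perm2413 {n : ℕ} (hn : 1 ≤ n) : (affineAvoiders n perm2413).Finite ∧
    ((affineAvoiders n perm2413).ncard : ℚ) = ∑ k ∈ Finset.range n,
      (((n : ℚ) - (k : ℚ)) / (n : ℚ)) * (Nat.choose (n - 1 + k) k : ℚ) * 2 ^ k := by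
  rw [← card_markedPerms_avoids2413 hn, Nat.cast_inj]
  refine affineAvoiders_finite_and_ncard hn (fun σ => exists_isCutOf_of_avoids2413 hn)
    fun σ l t hl hσ => ?_
  rw [containsPattern_perm2413_iff, ← periodicExt_2413_iff hl hn, hσ]
  unfold shiftedExt
  constructor
  · rintro ⟨i, j, k, m, h⟩
    exact ⟨i + t, j + t, k + t, m + t, by simp only at h; omega⟩
  · rintro ⟨i, j, k, m, h⟩
    exact ⟨i - t, j - t, k - t, m - t, by simp only [sub_add_cancel]; omega⟩

/-! ### Passing to inverses. -/

theorem containsPattern_inv {k : ℕ} {σ : Equiv.Perm ℤ} {τ : Equiv.Perm (Fin k)}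
    (h : ContainsPattern σ τ) : ContainsPattern σ⁻¹ τ⁻¹ := by
  obtain ⟨φ, hφ, h⟩ := h
  -- The values of the occurrence, listed in increasing order, are the positions of the occurrence
  -- in the inverse.
  refine ⟨fun a => σ (φ (τ⁻¹ a)), fun a b hab => ?_, fun a b => ?_⟩
  · rw [h]; simpa using hab
  · have : ∀ x, σ⁻¹ (σ x) = x := σ.symm_apply_apply
    simp only [this]
    exact hφ.lt_iff_lt

theorem containsPattern_inv_iff {k : ℕ} {σ : Equiv.Perm ℤ} {τ : Equiv.Perm (Fin k)} :
    ContainsPattern σ⁻¹ τ⁻¹ ↔ ContainsPattern σ τ :=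
  ⟨fun h => by simpa using containsPattern_inv h, containsPattern_inv⟩

/-- The displacement of `σ⁻¹` at `r` is minus that of `σ` at the residue of `σ⁻¹ r` modulo `n`, and
these residues permute `0, …, n - 1`. -/
theorem IsAffinePerm.inv {n : ℕ} (hn : 0 < n) {σ : Equiv.Perm ℤ} (h : IsAffinePerm n σ) :
    IsAffinePerm n σ⁻¹ := by
  obtain ⟨hper, hsum⟩ := (isAffinePerm_iff 0).1 h
  have hs : ∀ x, σ (σ⁻¹ x) = x := σ.apply_symm_apply
  have hinv : ∀ x, σ⁻¹ (x + n) = σ⁻¹ x + n := by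
    intro x
    apply σ.injective
    rw [hper, hs, hs]
  have hn' : (n : ℤ) ≠ 0 := by omega
  have hdiv : ∀ x : ℤ, n * (x / n) + x % n = x := fun x => Int.mul_ediv_add_emod x n
  refine (isAffinePerm_iff 0).2 ⟨hinv, ?_⟩
  simp only [zero_add] at hsum ⊢
  let s : ℕ → ℕ := fun r => (σ⁻¹ r % n).toNat
  have hcast : ∀ r, (s r : ℤ) = σ⁻¹ r % n := fun r =>
    Int.toNat_of_nonneg (Int.emod_nonneg _ hn')
  have hσs : ∀ r : ℕ, (r : ℤ) = n * (σ⁻¹ r / n) + σ (s r) := by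
    intro r
    rw [← apply_mul_add_of_periodic hper, hcast, hdiv, hs]
  have hmaps : ∀ r, s r ∈ Finset.range n := by
    intro r
    have := Int.emod_lt_of_pos (σ⁻¹ r) (show (0 : ℤ) < n by omega)
    have := hcast r
    rw [Finset.mem_range]; omega
  have hinj : Set.InjOn s (Finset.range n : Set ℕ) := by
    intro r hr r' hr' he
    have h1 := hσs r
    have h2 := hσs r'
    rw [he] at h1
    have h3 : (r : ℤ) % n = (r' : ℤ) % n := by
      rw [h1, h2, Int.mul_add_emod_self_left, Int.mul_add_emod_self_left]
    simp only [Finset.coe_range, Set.mem_Iio] at hr hr'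
    rw [Int.emod_eq_of_lt (by omega) (by omega), Int.emod_eq_of_lt (by omega) (by omega)] at h3
    exact_mod_cast h3
  have himg : (Finset.range n).image s = Finset.range n :=
    Finset.eq_of_subset_of_card_le (Finset.image_subset_iff.2 fun r _ => hmaps r)
      (Finset.card_image_of_injOn hinj).ge
  rw [← himg, Finset.sum_image hinj] at hsum
  rw [← neg_eq_zero, ← Finset.sum_neg_distrib, ← hsum]
  refine Finset.sum_congr rfl fun r _ => ?_
  have h1 := hσs r
  have h2 := hdiv (σ⁻¹ r)
  rw [← hcast] at h2
  linarith

theorem affineAvoiders_inv {n k : ℕ} (hn : 0 < n) (τ : Equiv.Perm (Fin k)) :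
    affineAvoiders n τ⁻¹ = (fun σ => σ⁻¹) '' affineAvoiders n τ := by
  ext σ
  constructor
  · rintro ⟨h1, h2⟩
    exact ⟨σ⁻¹, ⟨h1.inv hn, fun h => h2 (by simpa using containsPattern_inv h)⟩, inv_inv σ⟩
  · rintro ⟨σ, ⟨h1, h2⟩, rfl⟩
    exact ⟨h1.inv hn, fun h => h2 (containsPattern_inv_iff.1 h)⟩

theorem finite_and_ncard_affineAvoiders_inv {n k : ℕ} (hn : 0 < n) (τ : Equiv.Perm (Fin k))
    (h : (affineAvoiders n τ).Finite) : (affineAvoiders n τ⁻¹).Finite ∧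
      (affineAvoiders n τ⁻¹).ncard = (affineAvoiders n τ).ncard := by
  rw [affineAvoiders_inv hn]
  exact ⟨h.image _, Set.ncard_image_of_injective _ inv_injective⟩

theorem mainTheorem9 (n : ℕ) (hn : 1 ≤ n) :
    ((affineAvoiders n perm231).Finite ∧
      (affineAvoiders n perm231).ncard = Nat.choose (2 * n - 1) n) ∧
    ((affineAvoiders n perm312).Finite ∧
      (affineAvoiders n perm312).ncard = Nat.choose (2 * n - 1) n) ∧
    ((affineAvoiders n perm3142).Finite ∧
      ((affineAvoiders n perm3142).ncard : ℚ) =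
        ∑ k ∈ Finset.range n,
          (((n : ℚ) - (k : ℚ)) / (n : ℚ)) * (Nat.choose (n - 1 + k) k : ℚ) * 2 ^ k) ∧
    ((affineAvoiders n perm2413).Finite ∧
      ((affineAvoiders n perm2413).ncard : ℚ) =
        ∑ k ∈ Finset.range n,
          (((n : ℚ) - (k : ℚ)) / (n : ℚ)) * (Nat.choose (n - 1 + k) k : ℚ) * 2 ^ k) := by
  have h231 := affineAvoiders_perm231 hn
  have h2413 := affineAvoiders_perm2413 hn
  have h312 := finite_and_ncard_affineAvoiders_inv hn _ h231.1
  have h3142 := finite_and_ncard_affineAvoiders_inv hn _ h2413.1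
  rw [show perm231⁻¹ = perm312 from Equiv.ext (by decide)] at h312
  rw [show perm2413⁻¹ = perm3142 from Equiv.ext (by decide)] at h3142
  refine ⟨h231, ⟨h312.1, h312.2.trans h231.2⟩, ⟨h3142.1, ?_⟩, h2413⟩
  rw [h3142.2, h2413.2]
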